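/- Let $R$ be a random variable with values in $\{1,2,3,\dots\}$ such that $\mathbb{E}[R^{1+\varepsilon}]<\infty$ for some $\varepsilon>0$, and let $\mu=\mathbb{E}[R]$. For every integer $n\ge 1$ let $R_1,R_2,\dots$ be i.i.d. copies of $R$ and, independently of them, let $U_1,U_2,\dots$ be i.i.d. uniform points of the discrete torus $\mathbb{Z}/n\mathbb{Z}$. Put $C_0=\emptyset$ and $C_k=C_{k-1}\cup\{U_k,U_k+1,\dots,U_k+R_k-1\}\subset\mathbb{Z}/n\mathbb{Z}$ for $k\ge 1$, and let $\tau_n=\min\{k: C_k=\mathbb{Z}/n\mathbb{Z}\}$ be the discrete cover time. Let $(N(t))_{t\ge 0}$ be a Poisson process of rate $1$ independent of $(R_k)_k$ and $(U_k)_k$, put $X_t=C_{N(t)}$, and let $T_n=\inf\{t\ge 0: X_t=\mathbb{Z}/n\mathbb{Z}\}$ be the continuous-time cover time. Then, for every $n$, $\tau_n$ and $T_n$ are almost surely finite, and as $n\to\infty$ $$\frac{\mu}{n}T_n-\ln n\;\Longrightarrow\;\mathrm{Gumbel}(0,1)\qquad\text{and}\qquad \frac{\mu}{n}\tau_n-\ln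 n\;\Longrightarrow\;\mathrm{Gumbel}(0,1)$$ in distribution, where $\mathrm{Gumbel}(0,1)$ is the probability law on $\mathbb{R}$ with $\mathbb{P}(\mathrm{Gumbel}(0,1)<t)=\exp\{-\exp\{-t\}\}$ for all $t\in\mathbb{R}$. -/

import Mathlib

open MeasureTheory ProbabilityTheory Filter Topology Set
open scoped NNReal ENNReal

noncomputable section

namespace Covering

/-- The arc `{u, u + 1, …, u + r - 1}` of the discrete torus `ℤ/nℤ`, which starts at `u` and has
length `r` (it is the whole torus when `r ≥ n ≥ 1`). -/
def arc {n : ℕ} (u : ZMod n) (r : ℕ) : Set (ZMod n) :=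
  (fun j : ℕ => u + (j : ZMod n)) '' Set.Iio r

section CoverDefs

variable {Ω : Type*} {n : ℕ}

/-- The discrete covering process: `C 0 = ∅` and `C (k + 1)` is `C k` together with the next arc.
The objects are numbered from `0`, so that `C k` is the union of the first `k` of them. -/
def cover (R : ℕ → Ω → ℕ) (U : ℕ → Ω → ZMod n) : ℕ → Ω → Set (ZMod n)
  | 0, _ => ∅
  | k + 1, ω => cover R U k ω ∪ arc (U k ω) (R k ω)

/-- The discrete cover time `τ = min {k : C k = ℤ/nℤ}`. -/
def discreteCoverTime (R : ℕ → Ω → ℕ) (U : ℕ → Ω → ZMod n) (ω : Ω) : ℕ :=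
  sInf {k : ℕ | cover R U k ω = Set.univ}

/-- The continuous-time covering process `X t = C (N t)`. -/
def contCover (R : ℕ → Ω → ℕ) (U : ℕ → Ω → ZMod n) (N : ℝ≥0 → Ω → ℕ) (t : ℝ≥0) (ω : Ω) :
    Set (ZMod n) :=
  cover R U (N t ω) ω

/-- The continuous cover time `T = inf {t : X t = ℤ/nℤ}`. -/
def contCoverTime (R : ℕ → Ω → ℕ) (U : ℕ → Ω → ZMod n) (N : ℝ≥0 → Ω → ℕ) (ω : Ω) : ℝ≥0 :=
  sInf {t : ℝ≥0 | contCover R U N t ω = Set.univ}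

end CoverDefs

section Models

variable {Ω : Type*} [MeasurableSpace Ω]

/-- Under `P`, the radii `R k` are i.i.d. with law `ρ`, the positions `U k` are i.i.d. uniform on
`ℤ/nℤ`, and the two sequences are independent of each other. -/
structure IsArcSequence {n : ℕ} [NeZero n] (P : Measure Ω) (ρ : Measure ℕ)
    (R : ℕ → Ω → ℕ) (U : ℕ → Ω → ZMod n) : Prop where
  measurable_radius : ∀ k, Measurable (R k)
  measurable_position : ∀ k, Measurable (U k)
  law_radius : ∀ k, HasLaw (R k) ρ P
  law_position : ∀ k, HasLaw (U k) (PMF.uniformOfFintype (ZMod n)).toMeasure P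
  indep_radius : iIndepFun R P
  indep_position : iIndepFun U P
  indep : IndepFun (fun ω k => R k ω) (fun ω k => U k ω) P

/-- Under `P`, `N` is a Poisson process of rate `1` on `[0, ∞)`: almost surely its path starts at
`0`, is nondecreasing and right-continuous, its increments are independent, and the increment over
`(s, t]` is Poisson with parameter `t - s`. -/
structure IsUnitPoissonProcess (P : Measure Ω) (N : ℝ≥0 → Ω → ℕ) : Prop where
  measurable : ∀ t, Measurable (N t)
  zero : ∀ᵐ ω ∂P, N 0 ω = 0
  mono : ∀ᵐ ω ∂P, Monotone fun t => N t ω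
  rightCont : ∀ᵐ ω ∂P, ∀ t, ContinuousWithinAt (fun s => N s ω) (Set.Ici t) t
  law_increment : ∀ s t, s ≤ t → HasLaw (fun ω => N t ω - N s ω) (poissonMeasure (t - s)) P
  indep_increments : HasIndepIncrements (fun t ω => (N t ω : ℤ)) P

end Models

/-- The distribution function `t ↦ exp (-exp (-t))`. -/
def gumbelCDF : StieltjesFunction ℝ where
  toFun t := Real.exp (-Real.exp (-t))
  mono' := by
    intro a b h
    simp only [Real.exp_le_exp, neg_le_neg_iff]
    exact h
  right_continuous' t := by
    apply Continuous.continuousWithinAt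
    fun_prop

lemma tendsto_gumbelCDF_atBot : Tendsto gumbelCDF atBot (𝓝 0) :=
  Real.tendsto_exp_neg_atTop_nhds_zero.comp
    (Real.tendsto_exp_atTop.comp tendsto_neg_atBot_atTop)

lemma tendsto_gumbelCDF_atTop : Tendsto gumbelCDF atTop (𝓝 1) := by
  have h := (Real.continuous_exp.tendsto (-0)).comp
    (Real.tendsto_exp_neg_atTop_nhds_zero.neg)
  rw [neg_zero, Real.exp_zero] at h
  exact h

/-- The Gumbel distribution with parameters `0` and `1`. -/
def gumbel : Measure ℝ := gumbelCDF.measure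

instance : IsProbabilityMeasure gumbel :=
  gumbelCDF.isProbabilityMeasure tendsto_gumbelCDF_atBot tendsto_gumbelCDF_atTop

lemma gumbel_Iio (t : ℝ) : gumbel (Set.Iio t) = ENNReal.ofReal (Real.exp (-Real.exp (-t))) := by
  have hc : Continuous gumbelCDF := by
    change Continuous fun t => Real.exp (-Real.exp (-t))
    fun_prop
  rw [gumbel, gumbelCDF.measure_Iio tendsto_gumbelCDF_atBot, sub_zero,
    (hc.continuousAt.continuousWithinAt).leftLim_eq]
  rfl

end Covering

end

/-!
The torus is covered after `k` arcs exactly when the number `W` of uncovered sites vanishes, and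
`W` is asymptotically Poisson: its binomial moments converge to those of the Poisson distribution
with parameter `exp (-s)` when `μ k / n - log n → s`, and the Bonferroni inequalities
(`IsArcSequence.bonferroni`, `tendsto_of_bonferroni`) turn this into `P(W = 0) → exp (-exp (-s))`
(`tendsto_prob_covered`).

The `m`-th binomial moment is the sum, over the `m`-element sets `A` of sites, of the probability
`(1 - q(A)) ^ k` that `k` arcs avoid `A`, where `q(A)` is the probability that a single arc hits `A`
(`IsArcSequence.integral_choose`). The union bound `q(A) ≤ m μ / n` gives the lower bound. For the
upper bound, cut the torus open at `0` and let `g` run through the gaps between successive points of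
`A`, the first one counted from `-1`. An arc hits `A` if it starts within its length before a point
of `A`, and the starting sites lying in different gaps are different, so `n q(A) ≥ ∑ E[min(R, g)]`
(`sum_truncMean_gap_le`). Hence `(1 - q(A)) ^ k` is at most the product over the gaps of
`w(g) = exp (-κ E[min(R, g)])`, with `κ = k / n`, and the sum over `A` of such products is estimated
by choosing the points one at a time (`sum_gapProd_le`). Gaps below `d = ⌈exp (κ / 2)⌉` have total
weight at most `d exp (-κ) → 0`, since `R ≥ 1`. For the other gaps, the moment of order `1 + ε`
bounds `κ (μ - E[min(R, d)])` by a multiple of `κ d ^ (-ε) → 0`, so that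
`n w(d) → exp (-s)` (`exists_tendsto_sum_gapProd_le`).

In continuous time, right-continuity of the Poisson process shows that the cover time is at most `t`
exactly when the first `N(t)` arcs cover the torus. At `t` of order `n log n` the fluctuations of
`N(t)` are of order `√(n log n)`, which is negligible on the scale `n`, so both cover times have the
same limit.
-/

namespace Covering

/-! ### Gaps of a finite set and sums of products over gaps -/

/-- One more than the largest element of `A`, and `0` if `A` is empty. -/
def top (A : Finset ℕ) : ℕ := A.sup fun x => x + 1

/-- The distance from `x` to the previous element of `A`, where `-1` plays the role of the previous
element when there is none. -/
def gap (A : Finset ℕ) (x : ℕ) : ℕ := x + 1 - top (A.filter (· < x))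

/-- The product of `w` over all gaps of `A`. -/
def gapProd (w : ℕ → ℝ) (A : Finset ℕ) : ℝ := ∏ x ∈ A, w (gap A x)

lemma succ_le_top {A : Finset ℕ} {x : ℕ} (hx : x ∈ A) : x + 1 ≤ top A :=
  Finset.le_sup (f := fun x => x + 1) hx

lemma top_le {A : Finset ℕ} {n : ℕ} (h : ∀ x ∈ A, x < n) : top A ≤ n :=
  Finset.sup_le fun x hx => h x hx

lemma one_le_gap (A : Finset ℕ) (x : ℕ) : 1 ≤ gap A x := by
  have : top (A.filter (· < x)) ≤ x := top_le fun y hy => (Finset.mem_filter.1 hy).2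
  unfold gap; omega

lemma gapProd_insert (w : ℕ → ℝ) {B : Finset ℕ} {N : ℕ} (hN : top B ≤ N) :
    gapProd w (insert N B) = gapProd w B * w (N + 1 - top B) := by
  have hlt : ∀ y ∈ B, y < N := fun y hy => (succ_le_top hy).trans hN
  have hNB : N ∉ B := fun h => (hlt N h).false
  unfold gapProd
  rw [Finset.prod_insert hNB, mul_comm]
  congr 1
  · refine Finset.prod_congr rfl fun x hx => ?_
    unfold gap
    rw [Finset.filter_insert, if_neg (hlt x hx).not_gt]
  · unfold gap
    rw [Finset.filter_insert, if_neg (lt_irrefl N), Finset.filter_true_of_mem hlt]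

/-- A set with `m + 1` elements arises from one with `m` elements, together with the gap in front
of its largest element. -/
lemma powersetCard_succ_subset_image (n m : ℕ) :
    Finset.powersetCard (m + 1) (Finset.range n) ⊆
      (Finset.powersetCard m (Finset.range n) ×ˢ Finset.Icc 1 n).image
        fun p => insert (top p.1 + p.2 - 1) p.1 := by
  intro A hA
  obtain ⟨hAn, hAm⟩ := Finset.mem_powersetCard.1 hA
  have hne : A.Nonempty := Finset.card_pos.1 (by omega)
  set N := A.max' hne with hN
  have hNA : N ∈ A := A.max'_mem hne
  have hNn : N < n := Finset.mem_range.1 (hAn hNA)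
  have htop : top (A.erase N) ≤ N := top_le fun x hx => A.lt_max'_of_mem_erase_max' hne hx
  refine Finset.mem_image.2 ⟨(A.erase N, N + 1 - top (A.erase N)), ?_, ?_⟩
  · simp only [Finset.mem_product, Finset.mem_powersetCard, Finset.mem_Icc,
      Finset.card_erase_of_mem hNA]
    exact ⟨⟨(Finset.erase_subset _ _).trans hAn, by omega⟩, by omega, by omega⟩
  · have : top (A.erase N) + (N + 1 - top (A.erase N)) - 1 = N := by omega
    simp only [this, Finset.insert_erase hNA]

lemma sum_powersetCard_succ_le {F G : Finset ℕ → ℝ} {v : ℕ → ℝ} (n m : ℕ) (hF : ∀ A, 0 ≤ F A)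
    (h : ∀ B : Finset ℕ, ∀ N, top B ≤ N → F (insert N B) ≤ G B * v (N + 1 - top B)) :
    ∑ A ∈ Finset.powersetCard (m + 1) (Finset.range n), F A ≤
      (∑ B ∈ Finset.powersetCard m (Finset.range n), G B) * ∑ g ∈ Finset.Icc 1 n, v g := by
  classical
  refine (Finset.sum_le_sum_of_subset_of_nonneg (powersetCard_succ_subset_image n m)
    fun A _ _ => hF A).trans ?_
  refine (Finset.sum_image_le_of_nonneg fun A _ => hF _).trans ?_
  rw [Finset.sum_mul_sum, ← Finset.sum_product']
  refine Finset.sum_le_sum fun p hp => ?_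
  obtain ⟨-, hp2⟩ := Finset.mem_product.1 hp
  obtain ⟨h1, -⟩ := Finset.mem_Icc.1 hp2
  refine (h p.1 (top p.1 + p.2 - 1) (by omega)).trans_eq ?_
  congr 2
  omega

lemma gapProd_nonneg {w : ℕ → ℝ} (hw : ∀ g, 0 ≤ w g) (A : Finset ℕ) : 0 ≤ gapProd w A :=
  Finset.prod_nonneg fun _ _ => hw _

lemma sum_gapProd_le_pow {w : ℕ → ℝ} (hw : ∀ g, 0 ≤ w g) (n m : ℕ) :
    ∑ A ∈ Finset.powersetCard m (Finset.range n), gapProd w A ≤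
      (∑ g ∈ Finset.Icc 1 n, w g) ^ m := by
  induction m with
  | zero => simp [gapProd]
  | succ m ih =>
    refine (sum_powersetCard_succ_le n m (gapProd_nonneg hw)
      fun B N hN => (gapProd_insert w hN).le).trans ?_
    rw [pow_succ]
    exact mul_le_mul_of_nonneg_right ih (Finset.sum_nonneg fun _ _ => hw _)

/-- If `v ≤ w`, then `∑ (∏ w - ∏ v)` is controlled by the total mass of `w - v`: in each set, one
of the gaps contributes a factor `w - v`. -/
lemma sum_gapProd_sub_le {v w : ℕ → ℝ} (hv : ∀ g, 0 ≤ v g) (hvw : ∀ g, v g ≤ w g) (n m : ℕ) :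
    ∑ A ∈ Finset.powersetCard m (Finset.range n), (gapProd w A - gapProd v A) ≤
      m * (∑ g ∈ Finset.Icc 1 n, (w g - v g)) * (∑ g ∈ Finset.Icc 1 n, w g) ^ (m - 1) := by
  have hw : ∀ g, 0 ≤ w g := fun g => (hv g).trans (hvw g)
  have hle : ∀ A, 0 ≤ gapProd w A - gapProd v A := fun A =>
    sub_nonneg.2 (Finset.prod_le_prod (fun _ _ => hv _) fun _ _ => hvw _)
  have hZ : 0 ≤ ∑ g ∈ Finset.Icc 1 n, w g := Finset.sum_nonneg fun _ _ => hw _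
  have hZs : 0 ≤ ∑ g ∈ Finset.Icc 1 n, (w g - v g) :=
    Finset.sum_nonneg fun g _ => sub_nonneg.2 (hvw g)
  induction m with
  | zero => simp [gapProd]
  | succ m ih =>
    set Z := ∑ g ∈ Finset.Icc 1 n, w g
    set Zs := ∑ g ∈ Finset.Icc 1 n, (w g - v g)
    -- `∏ w - ∏ v` splits according to whether the gaps below the largest element differ.
    classical
    let p : Finset ℕ → Finset ℕ := fun A => A.filter fun x => x + 1 < top A
    have hp : ∀ B : Finset ℕ, ∀ N, top B ≤ N → p (insert N B) = B ∧ top (insert N B) = N + 1 := by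
      intro B N hN
      have htop : top (insert N B) = N + 1 := by
        unfold top at hN ⊢
        rw [Finset.sup_insert]
        exact sup_eq_left.2 (hN.trans N.le_succ)
      refine ⟨?_, htop⟩
      have hlt : ∀ y ∈ B, y < N := fun y hy => (succ_le_top hy).trans hN
      simp only [p, htop]
      rw [Finset.filter_insert, if_neg (lt_irrefl _),
        Finset.filter_true_of_mem fun y hy => Nat.succ_lt_succ (hlt y hy)]
    let F₁ : Finset ℕ → ℝ := fun A => (gapProd w (p A) - gapProd v (p A)) * w (top A - top (p A))
    let F₂ : Finset ℕ → ℝ := fun A =>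
      gapProd v (p A) * (w (top A - top (p A)) - v (top A - top (p A)))
    have hsplit : ∀ A ∈ Finset.powersetCard (m + 1) (Finset.range n),
        gapProd w A - gapProd v A = F₁ A + F₂ A := by
      intro A hA
      obtain ⟨⟨B, g⟩, hBg, rfl⟩ := Finset.mem_image.1 (powersetCard_succ_subset_image n m hA)
      obtain ⟨-, hp2⟩ := Finset.mem_product.1 hBg
      obtain ⟨h1, -⟩ := Finset.mem_Icc.1 hp2
      have hN : top B ≤ top B + g - 1 := by simp only at h1; omega
      obtain ⟨e1, e2⟩ := hp B _ hN
      simp only [F₁, F₂, e1, e2]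
      rw [gapProd_insert w hN, gapProd_insert v hN]
      ring
    rw [Finset.sum_congr rfl hsplit, Finset.sum_add_distrib]
    have h1 : ∑ A ∈ Finset.powersetCard (m + 1) (Finset.range n), F₁ A ≤
        (∑ B ∈ Finset.powersetCard m (Finset.range n), (gapProd w B - gapProd v B)) * Z := by
      refine sum_powersetCard_succ_le n m (fun A => mul_nonneg (hle _) (hw _)) fun B N hN => ?_
      obtain ⟨e1, e2⟩ := hp B N hN
      simp only [F₁, e1, e2, le_refl]
    have h2 : ∑ A ∈ Finset.powersetCard (m + 1) (Finset.range n), F₂ A ≤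
        (∑ B ∈ Finset.powersetCard m (Finset.range n), gapProd v B) * Zs := by
      refine sum_powersetCard_succ_le (v := fun g => w g - v g) n m
        (fun A => mul_nonneg (gapProd_nonneg hv _) (sub_nonneg.2 (hvw _))) fun B N hN => ?_
      obtain ⟨e1, e2⟩ := hp B N hN
      simp only [F₂, e1, e2, le_refl]
    have h3 : ∑ B ∈ Finset.powersetCard m (Finset.range n), gapProd v B ≤ Z ^ m :=
      (Finset.sum_le_sum fun A _ => sub_nonneg.1 (hle A)).trans (sum_gapProd_le_pow hw n m)
    have h4 := mul_le_mul_of_nonneg_right ih hZ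
    have h5 := mul_le_mul_of_nonneg_right h3 hZs
    have h6 : (m : ℝ) * Zs * Z ^ (m - 1) * Z = m * Zs * Z ^ m := by
      cases m with
      | zero => simp
      | succ m => simp [pow_succ]; ring
    rw [Nat.add_sub_cancel]
    push_cast
    linarith

/-- A sum of products over gaps is at most the contribution of the sets all of whose gaps are at
least `d`, plus an error from gaps smaller than `d`. -/
lemma sum_gapProd_le {w : ℕ → ℝ} (hw : ∀ g, 0 ≤ w g) (hanti : Antitone w) (n m d : ℕ) :
    ∑ A ∈ Finset.powersetCard m (Finset.range n), gapProd w A ≤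
      n.choose m * w d ^ m +
        m * (∑ g ∈ Finset.Ico 1 d, w g) * (∑ g ∈ Finset.Icc 1 n, w g) ^ (m - 1) := by
  let v : ℕ → ℝ := fun g => if d ≤ g then w g else 0
  have hv : ∀ g, 0 ≤ v g := fun g => by
    simp only [v]; split_ifs <;> simp [hw]
  have hvw : ∀ g, v g ≤ w g := fun g => by
    simp only [v]; split_ifs <;> simp [hw]
  have hvd : ∀ g, v g ≤ w d := fun g => by
    simp only [v]; split_ifs with h
    · exact hanti h
    · exact hw d
  have h1 := sum_gapProd_sub_le hv hvw n m
  rw [Finset.sum_sub_distrib] at h1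
  have h2 : ∑ A ∈ Finset.powersetCard m (Finset.range n), gapProd v A ≤ n.choose m * w d ^ m := by
    refine (Finset.sum_le_card_nsmul _ _ (w d ^ m) fun A hA => ?_).trans_eq ?_
    · rw [← (Finset.mem_powersetCard.1 hA).2]
      exact (Finset.prod_le_prod (fun x _ => hv _) fun x _ => hvd _).trans_eq (Finset.prod_const _)
    · simp
  have h3 : ∑ g ∈ Finset.Icc 1 n, (w g - v g) ≤ ∑ g ∈ Finset.Ico 1 d, w g := by
    have : ∀ g, w g - v g = if g < d then w g else 0 := fun g => by
      simp only [v]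
      by_cases h : d ≤ g
      · simp [h, h.not_gt]
      · simp [h, not_le.1 h]
    simp_rw [this]
    rw [← Finset.sum_filter]
    refine Finset.sum_le_sum_of_subset_of_nonneg (fun g hg => ?_) fun _ _ _ => hw _
    simp only [Finset.mem_filter, Finset.mem_Icc, Finset.mem_Ico] at hg ⊢
    omega
  have h4 : (m : ℝ) * (∑ g ∈ Finset.Icc 1 n, (w g - v g)) * (∑ g ∈ Finset.Icc 1 n, w g) ^ (m - 1) ≤
      m * (∑ g ∈ Finset.Ico 1 d, w g) * (∑ g ∈ Finset.Icc 1 n, w g) ^ (m - 1) := by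
    have : 0 ≤ ∑ g ∈ Finset.Icc 1 n, w g := Finset.sum_nonneg fun _ _ => hw _
    gcongr
  linarith

/-! ### The arcs that hit a set -/

/-- An arc of length `r` started fewer than `r` sites before a point `x` of `A` contains `x`. For
different points `x`, the starting sites closer to `x` than `gap A x` are different. Nothing wraps
around, because the first gap ends at `0`. -/
lemma sum_min_gap_le_card {n : ℕ} [NeZero n] {A : Finset ℕ} (hA : A ⊆ Finset.range n) (r : ℕ) :
    ∑ x ∈ A, min r (gap A x) ≤
      Nat.card {u : ZMod n | ∃ x ∈ A, (x : ZMod n) ∈ arc u r} := by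
  classical
  let D : ℕ → Finset ℕ := fun x => Finset.Ico (x + 1 - min r (gap A x)) (x + 1)
  have hgap : ∀ x, gap A x ≤ x + 1 := fun x => Nat.sub_le _ _
  have hcard : ∀ x, (D x).card = min r (gap A x) := fun x => by
    simp only [D, Nat.card_Ico]
    have := hgap x
    omega
  have hdisj' : ∀ x ∈ A, ∀ y ∈ A, y < x → Disjoint (D y) (D x) := by
    intro x _ y hy hyx
    have h1 : y + 1 ≤ top (A.filter (· < x)) := succ_le_top (Finset.mem_filter.2 ⟨hy, hyx⟩)
    have h2 : top (A.filter (· < x)) ≤ x := top_le fun y hy => (Finset.mem_filter.1 hy).2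
    rw [Finset.disjoint_left]
    intro u hu hu'
    simp only [D, Finset.mem_Ico, gap] at hu hu'
    omega
  have hdisj : ∀ x ∈ A, ∀ y ∈ A, x ≠ y → Disjoint (D x) (D y) := by
    intro x hx y hy hxy
    rcases lt_or_gt_of_ne hxy with h | h
    · exact hdisj' y hy x hx h
    · exact (hdisj' x hx y hy h).symm
  calc ∑ x ∈ A, min r (gap A x) = (A.biUnion D).card := by
        rw [Finset.card_biUnion hdisj]
        exact Finset.sum_congr rfl fun x _ => (hcard x).symm
    _ = ((A.biUnion D).image fun u : ℕ => (u : ZMod n)).card := by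
        refine (Finset.card_image_of_injOn fun u hu u' hu' h => ?_).symm
        have hlt : ∀ u ∈ A.biUnion D, u < n := by
          intro u hu
          obtain ⟨x, hx, hux⟩ := Finset.mem_biUnion.1 hu
          have := Finset.mem_range.1 (hA hx)
          have := (Finset.mem_Ico.1 hux).2
          omega
        have := (ZMod.natCast_eq_natCast_iff' u u' n).1 h
        rwa [Nat.mod_eq_of_lt (hlt u hu), Nat.mod_eq_of_lt (hlt u' hu')] at this
    _ ≤ _ := by
        rw [Nat.card_coe_set_eq, ← Set.ncard_coe_finset]
        refine Set.ncard_le_ncard (fun u hu => ?_) (Set.toFinite _)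
        obtain ⟨v, hv, rfl⟩ := Finset.mem_image.1 (Finset.mem_coe.1 hu)
        obtain ⟨x, hx, hvx⟩ := Finset.mem_biUnion.1 hv
        simp only [D, Finset.mem_Ico] at hvx
        refine ⟨x, hx, x - v, ?_, ?_⟩
        · have := hgap x
          simp only [Set.mem_Iio]
          omega
        · simp only
          rw [← Nat.cast_add]
          congr 1
          omega

lemma card_arcs_hitting_le {n : ℕ} [NeZero n] (A : Finset ℕ) (r : ℕ) :
    Nat.card {u : ZMod n | ∃ x ∈ A, (x : ZMod n) ∈ arc u r} ≤ A.card * r := by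
  classical
  have hsub : {u : ZMod n | ∃ x ∈ A, (x : ZMod n) ∈ arc u r} ⊆
      ((A ×ˢ Finset.range r).image fun p => (p.1 : ZMod n) - (p.2 : ZMod n) : Finset (ZMod n)) := by
    rintro u ⟨x, hx, j, hj, hxj⟩
    refine Finset.mem_coe.2 (Finset.mem_image.2 ⟨(x, j), ?_, ?_⟩)
    · exact Finset.mem_product.2 ⟨hx, Finset.mem_range.2 hj⟩
    · simp only at hxj ⊢
      rw [← hxj]; ring
  rw [Nat.card_coe_set_eq]
  refine (Set.ncard_le_ncard hsub (Set.toFinite _)).trans ?_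
  rw [Set.ncard_coe_finset]
  refine Finset.card_image_le.trans ?_
  simp

/-! ### Asymptotics of the factorial moments -/

section Asymptotics

variable {ι : Type*} {l : Filter ι} {n k : ι → ℕ} {μ s : ℝ}

lemma tendsto_rate_atTop (hμ : 0 < μ) (hn : Tendsto n l atTop)
    (hk : Tendsto (fun i => μ * k i / n i - Real.log (n i)) l (𝓝 s)) :
    Tendsto (fun i => (k i : ℝ) / n i) l atTop := by
  have h1 : Tendsto (fun i => Real.log (n i)) l atTop :=
    Real.tendsto_log_atTop.comp (tendsto_natCast_atTop_atTop.comp hn)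
  have h2 := (hk.add_atTop h1).const_mul_atTop (inv_pos.2 hμ)
  refine h2.congr fun i => ?_
  field_simp
  ring

lemma tendsto_mul_exp_neg_rate (hn : Tendsto n l atTop) {h : ι → ℝ}
    (hk : Tendsto (fun i => μ * k i / n i - Real.log (n i)) l (𝓝 s))
    (hh : Tendsto (fun i => k i / n i * (μ - h i)) l (𝓝 0)) :
    Tendsto (fun i => (n i : ℝ) * Real.exp (-(k i / n i * h i))) l (𝓝 (Real.exp (-s))) := by
  have h1 : Tendsto (fun i => Real.exp (-(μ * k i / n i - Real.log (n i)) +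
      k i / n i * (μ - h i))) l (𝓝 (Real.exp (-s))) := by
    have := (Real.continuous_exp.tendsto _).comp (hk.neg.add hh)
    rwa [add_zero] at this
  refine h1.congr' ?_
  filter_upwards [hn.eventually_ge_atTop 1] with i hi
  have : (0 : ℝ) < n i := by exact_mod_cast hi
  conv_rhs => rw [← Real.exp_log this, ← Real.exp_add]
  rw [Real.exp_log this]
  congr 1
  ring

lemma tendsto_choose_mul_pow {p : ι → ℝ} {c : ℝ} (hn : Tendsto n l atTop)
    (hp : Tendsto (fun i => n i * p i) l (𝓝 c)) (m : ℕ) :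
    Tendsto (fun i => ((n i).choose m : ℝ) * p i ^ m) l (𝓝 (c ^ m / m.factorial)) := by
  have h1 : Tendsto (fun j : ℕ => (j.choose m : ℝ) * ((j : ℝ)⁻¹) ^ m) atTop
      (𝓝 (1 ^ m / m.factorial)) := by
    refine tendsto_choose_mul_pow_atTop _ (tendsto_const_nhds.congr' ?_)
    filter_upwards [eventually_ge_atTop 1] with j hj
    have : (0 : ℝ) < j := by exact_mod_cast hj
    field_simp
  have h2 := (h1.comp hn).mul (hp.pow m)
  have e : (1 : ℝ) ^ m / m.factorial * c ^ m = c ^ m / m.factorial := by ring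
  rw [e] at h2
  refine h2.congr' ?_
  filter_upwards [hn.eventually_ge_atTop 1] with i hi
  have : (0 : ℝ) < n i := by exact_mod_cast hi
  simp only [Function.comp, mul_pow, inv_pow]
  field_simp

lemma tendsto_rate_div (hn : Tendsto n l atTop)
    (hk : Tendsto (fun i => μ * k i / n i - Real.log (n i)) l (𝓝 s)) :
    Tendsto (fun i => μ * k i / n i / n i) l (𝓝 0) := by
  have hn' : Tendsto (fun i => (n i : ℝ)) l atTop := tendsto_natCast_atTop_atTop.comp hn
  have h1 : Tendsto (fun i => Real.log (n i) / n i) l (𝓝 0) :=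
    (Real.isLittleO_log_id_atTop.tendsto_div_nhds_zero).comp hn'
  have h2 := (hk.div_atTop hn').add h1
  rw [add_zero] at h2
  refine h2.congr fun i => ?_
  ring

lemma exp_neg_le_one_sub {x : ℝ} (h : x ≤ 1 / 2) :
    Real.exp (-(x + 2 * x ^ 2)) ≤ 1 - x := by
  have hx : 0 < 1 - x := by linarith
  rw [← Real.le_log_iff_exp_le hx]
  refine le_trans ?_ (Real.one_sub_inv_le_log_of_pos hx)
  have : (1 - x)⁻¹ ≤ 1 + x + 2 * x ^ 2 := by
    rw [inv_le_iff_one_le_mul₀' hx]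
    nlinarith [mul_nonneg (sq_nonneg x) (by linarith : 0 ≤ 1 - 2 * x)]
  linarith

/-- If all sets with `m` elements were hit with the largest possible probability `m μ / n`, the
`m`-th binomial moment would have the Poisson limit. -/
lemma exists_tendsto_le_choose_mul_pow (hμ : 0 < μ) (hn : Tendsto n l atTop)
    (hk : Tendsto (fun i => μ * k i / n i - Real.log (n i)) l (𝓝 s)) (m : ℕ) :
    ∃ L : ι → ℝ, Tendsto L l (𝓝 (Real.exp (-s) ^ m / m.factorial)) ∧
      ∀ᶠ i in l, m * μ / n i ≤ 1 ∧ L i ≤ (n i).choose m * (1 - m * μ / n i) ^ k i := by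
  have hn' : Tendsto (fun i => (n i : ℝ)) l atTop := tendsto_natCast_atTop_atTop.comp hn
  -- `L` replaces `1 - x` by `exp (-x - 2 x ^ 2)`, where `x = m μ / n`.
  refine ⟨fun i => (n i).choose m * (Real.exp (-(k i / n i * μ))) ^ m *
    Real.exp (-(2 * m ^ 2 * μ * (μ * k i / n i / n i))), ?_, ?_⟩
  · have h1 : Tendsto (fun i => (n i : ℝ) * Real.exp (-(k i / n i * μ))) l (𝓝 (Real.exp (-s))) :=
      tendsto_mul_exp_neg_rate hn hk (by simpa using tendsto_const_nhds)
    have h2 := (Real.continuous_exp.tendsto _).comp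
      (((tendsto_rate_div hn hk).const_mul (2 * m ^ 2 * μ)).neg)
    have h3 := (tendsto_choose_mul_pow hn h1 m).mul h2
    simpa using h3
  · have h0 : Tendsto (fun i => m * μ / (n i : ℝ)) l (𝓝 0) := tendsto_const_nhds.div_atTop hn'
    filter_upwards [h0.eventually_le_const (by norm_num : (0 : ℝ) < 1 / 2),
      hn.eventually_ge_atTop 1] with i hi hi1
    have hni : (0 : ℝ) < n i := by exact_mod_cast hi1
    refine ⟨by linarith, ?_⟩
    have h1 := exp_neg_le_one_sub hi
    have h2 := pow_le_pow_left₀ (Real.exp_pos _).le h1 (k i)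
    rw [mul_assoc]
    refine mul_le_mul_of_nonneg_left (le_trans (le_of_eq ?_) h2) (Nat.cast_nonneg _)
    rw [← Real.exp_nat_mul, ← Real.exp_nat_mul, ← Real.exp_add]
    congr 1
    field_simp
    ring

/-- The upper bound for the `m`-th binomial moment has the Poisson limit. The gaps smaller than
`d = ⌈exp (κ / 2)⌉`, where `κ = k / n`, have total weight at most `d exp (-κ) → 0`, and for the
others `κ (μ - h d) ≤ C κ d ^ (-ε) → 0`. -/
lemma exists_tendsto_sum_gapProd_le {h : ℕ → ℝ} {ε C : ℝ} (hμ : 0 < μ) (hε : 0 < ε) (hC : 0 ≤ C)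
    (hmono : Monotone h) (h1 : ∀ g, 1 ≤ g → 1 ≤ h g) (hle : ∀ g, h g ≤ μ)
    (htail : ∀ g : ℕ, 1 ≤ g → μ - h g ≤ C * (g : ℝ) ^ (-ε))
    (hn : Tendsto n l atTop)
    (hk : Tendsto (fun i => μ * k i / n i - Real.log (n i)) l (𝓝 s)) (m : ℕ) :
    ∃ B : ι → ℝ, Tendsto B l (𝓝 (Real.exp (-s) ^ m / m.factorial)) ∧
      ∀ i, ∑ A ∈ Finset.powersetCard m (Finset.range (n i)),
        gapProd (fun g => Real.exp (-(k i / n i * h g))) A ≤ B i := by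
  let κ : ι → ℝ := fun i => k i / n i
  have hκ0 : ∀ i, 0 ≤ κ i := fun i => by positivity
  have hκ : Tendsto κ l atTop := tendsto_rate_atTop hμ hn hk
  let d : ι → ℕ := fun i => ⌈Real.exp (κ i / 2)⌉₊
  have hdle : ∀ i, Real.exp (κ i / 2) ≤ d i := fun i => Nat.le_ceil _
  have hd1 : ∀ i, 1 ≤ d i := fun i => Nat.one_le_ceil_iff.2 (Real.exp_pos _)
  let w : ι → ℕ → ℝ := fun i g => Real.exp (-(κ i * h g))
  -- the total weight of the small gaps
  let z : ι → ℝ := fun i => d i * Real.exp (-κ i)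
  have hz : Tendsto z l (𝓝 0) := by
    have h2 : Tendsto (fun i => Real.exp (-(κ i / 2)) + Real.exp (-κ i)) l (𝓝 (0 + 0)) :=
      (Real.tendsto_exp_neg_atTop_nhds_zero.comp (hκ.atTop_div_const two_pos)).add
        (Real.tendsto_exp_neg_atTop_nhds_zero.comp hκ)
    rw [add_zero] at h2
    refine squeeze_zero (fun i => by positivity) (fun i => ?_) h2
    calc z i ≤ (Real.exp (κ i / 2) + 1) * Real.exp (-κ i) := by
          have := (Nat.ceil_lt_add_one (Real.exp_pos (κ i / 2)).le).le
          simp only [z, d]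
          gcongr
      _ = _ := by
          rw [add_mul, ← Real.exp_add, one_mul]
          congr 2
          ring
  have hwd : Tendsto (fun i => (n i : ℝ) * w i (d i)) l (𝓝 (Real.exp (-s))) := by
    refine tendsto_mul_exp_neg_rate (μ := μ) hn hk ?_
    have h2 : Tendsto (fun i => C * (κ i ^ (1 : ℝ) * Real.exp (-(ε / 2) * κ i))) l (𝓝 (C * 0)) :=
      ((tendsto_rpow_mul_exp_neg_mul_atTop_nhds_zero 1 (ε / 2) (by positivity)).comp hκ).const_mul C
    rw [mul_zero] at h2
    refine squeeze_zero (fun i => mul_nonneg (hκ0 i) (sub_nonneg.2 (hle _))) (fun i => ?_) h2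
    have h3 : (d i : ℝ) ^ (-ε) ≤ Real.exp (-(ε / 2) * κ i) := by
      refine (Real.rpow_le_rpow_of_nonpos (Real.exp_pos _) (hdle i) (by linarith)).trans_eq ?_
      rw [← Real.exp_mul]
      congr 1
      ring
    calc κ i * (μ - h (d i)) ≤ κ i * (C * Real.exp (-(ε / 2) * κ i)) :=
          mul_le_mul_of_nonneg_left ((htail _ (hd1 i)).trans (by gcongr)) (hκ0 i)
      _ = _ := by rw [Real.rpow_one]; ring
  have hw0 : ∀ i g, 0 ≤ w i g := fun i g => (Real.exp_pos _).le
  have hanti : ∀ i, Antitone (w i) := fun i a b hab =>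
    Real.exp_le_exp.2 (neg_le_neg (mul_le_mul_of_nonneg_left (hmono hab) (hκ0 i)))
  have hsmall : ∀ i, ∑ g ∈ Finset.Ico 1 (d i), w i g ≤ z i := fun i => by
    refine (Finset.sum_le_card_nsmul _ _ (Real.exp (-κ i)) fun g hg => ?_).trans ?_
    · have := h1 g (Finset.mem_Ico.1 hg).1
      exact Real.exp_le_exp.2 (neg_le_neg (by nlinarith [hκ0 i]))
    · rw [nsmul_eq_mul, Nat.card_Ico]
      exact mul_le_mul_of_nonneg_right (by exact_mod_cast Nat.sub_le _ _) (Real.exp_pos _).le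
  have htotal : ∀ i, ∑ g ∈ Finset.Icc 1 (n i), w i g ≤ z i + n i * w i (d i) := fun i => by
    have hsub : Finset.Icc 1 (n i) ⊆ Finset.Ico 1 (d i) ∪ Finset.Icc (d i) (n i) := fun g hg => by
      simp only [Finset.mem_Icc, Finset.mem_union, Finset.mem_Ico] at hg ⊢
      omega
    refine (Finset.sum_le_sum_of_subset_of_nonneg hsub fun _ _ _ => hw0 i _).trans ?_
    rw [Finset.sum_union (Finset.disjoint_left.2 fun g hg hg' => by
      simp only [Finset.mem_Icc, Finset.mem_Ico] at hg hg'
      omega)]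
    refine add_le_add (hsmall i) ?_
    refine (Finset.sum_le_card_nsmul _ _ (w i (d i)) fun g hg =>
      hanti i (Finset.mem_Icc.1 hg).1).trans ?_
    rw [nsmul_eq_mul, Nat.card_Icc]
    have := hd1 i
    refine mul_le_mul_of_nonneg_right ?_ (hw0 i _)
    exact_mod_cast (by omega : n i + 1 - d i ≤ n i)
  refine ⟨fun i => (n i).choose m * w i (d i) ^ m +
    m * z i * (z i + n i * w i (d i)) ^ (m - 1), ?_, fun i => ?_⟩
  · have h2 := (tendsto_choose_mul_pow hn hwd m).add
      ((hz.const_mul (m : ℝ)).mul ((hz.add hwd).pow (m - 1)))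
    simpa using h2
  · refine (sum_gapProd_le (hw0 i) (hanti i) (n i) m (d i)).trans ?_
    have h3 : 0 ≤ ∑ g ∈ Finset.Icc 1 (n i), w i g := Finset.sum_nonneg fun _ _ => hw0 i _
    have h4 : 0 ≤ z i := by positivity
    refine add_le_add_right (mul_le_mul (mul_le_mul_of_nonneg_left (hsmall i) (Nat.cast_nonneg _))
      (pow_le_pow_left₀ h3 (htotal i) _) (pow_nonneg h3 _) (by positivity)) _

/-- If the binomial moments of counting variables converge to those of the Poisson distribution
with parameter `c` and `a` satisfies the Bonferroni inequalities, then `a → exp (-c)`. -/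
lemma tendsto_of_bonferroni {a : ι → ℝ} {S : ℕ → ι → ℝ} {c : ℝ}
    (hS : ∀ j, Tendsto (S j) l (𝓝 (c ^ j / j.factorial)))
    (hlow : ∀ M, ∀ᶠ i in l, ∑ j ∈ Finset.range (2 * M), (-1) ^ j * S j i ≤ a i)
    (hupp : ∀ M, ∀ᶠ i in l, a i ≤ ∑ j ∈ Finset.range (2 * M + 1), (-1) ^ j * S j i) :
    Tendsto a l (𝓝 (Real.exp (-c))) := by
  have hlim : ∀ M, Tendsto (fun i => ∑ j ∈ Finset.range M, (-1) ^ j * S j i) l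
      (𝓝 (∑ j ∈ Finset.range M, (-c) ^ j / j.factorial)) := fun M => by
    refine tendsto_finsetSum _ fun j _ => ?_
    have := (hS j).const_mul ((-1) ^ j)
    rwa [← mul_div_assoc, ← mul_pow, neg_one_mul] at this
  have hexp : Tendsto (fun M => ∑ j ∈ Finset.range M, (-c) ^ j / j.factorial) atTop
      (𝓝 (Real.exp (-c))) := by
    rw [Real.exp_eq_exp_ℝ]
    exact (NormedSpace.expSeries_div_hasSum_exp (-c)).tendsto_sum_nat
  have htwo : Tendsto (fun M : ℕ => 2 * M) atTop atTop :=
    tendsto_id.const_mul_atTop' two_pos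
  refine tendsto_order.2 ⟨fun b hb => ?_, fun b hb => ?_⟩
  · obtain ⟨M, hM⟩ := ((hexp.comp htwo).eventually_const_lt hb).exists
    filter_upwards [hlow M, (hlim (2 * M)).eventually_const_lt hM] with i h1 h2
    exact h2.trans_le h1
  · obtain ⟨M, hM⟩ :=
      ((hexp.comp (tendsto_atTop_mono (fun M => Nat.le_succ _) htwo)).eventually_lt_const hb).exists
    filter_upwards [hupp M, (hlim (2 * M + 1)).eventually_lt_const hM] with i h1 h2
    exact h1.trans_lt h2

end Asymptotics

/-! ### The truncated mean length of an arc -/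

/-- The mean `E[min(R, g)]` of the arc length truncated at `g`. -/
noncomputable def truncMean (ρ : Measure ℕ) (g : ℕ) : ℝ := ∫ r : ℕ, ((min r g : ℕ) : ℝ) ∂ρ

section TruncMean

variable {ρ : Measure ℕ}

lemma integrable_length {ε : ℝ} (hε : 0 < ε)
    (hint : Integrable (fun r : ℕ => (r : ℝ) ^ (1 + ε)) ρ) :
    Integrable (fun r : ℕ => (r : ℝ)) ρ := by
  refine hint.mono' Measurable.of_discrete.aestronglyMeasurable <| .of_forall fun r => ?_
  rw [Real.norm_of_nonneg (Nat.cast_nonneg _)]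
  rcases Nat.eq_zero_or_pos r with rfl | hr
  · simpa using Real.rpow_nonneg le_rfl _
  · exact Real.self_le_rpow_of_one_le (by exact_mod_cast hr) (by linarith)

variable [IsProbabilityMeasure ρ]

lemma integrable_min (g : ℕ) : Integrable (fun r : ℕ => ((min r g : ℕ) : ℝ)) ρ :=
  .of_bound Measurable.of_discrete.aestronglyMeasurable (g : ℝ) <| .of_forall fun r => by
    rw [Real.norm_of_nonneg (Nat.cast_nonneg _)]
    exact_mod_cast min_le_right _ _

lemma truncMean_mono : Monotone (truncMean ρ) := fun a b hab =>
  integral_mono (integrable_min a) (integrable_min b) fun r => by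
    simp only
    exact_mod_cast min_le_min le_rfl hab

lemma one_le_truncMean (hρ : ∀ᵐ r ∂ρ, 1 ≤ r) {g : ℕ} (hg : 1 ≤ g) : 1 ≤ truncMean ρ g := by
  have : ∫ _ : ℕ, (1 : ℝ) ∂ρ ≤ truncMean ρ g := by
    refine integral_mono_ae (integrable_const _) (integrable_min g) ?_
    filter_upwards [hρ] with r hr
    exact_mod_cast le_min hr hg
  simpa using this

lemma truncMean_le (hint : Integrable (fun r : ℕ => (r : ℝ)) ρ) (g : ℕ) :
    truncMean ρ g ≤ ∫ r : ℕ, (r : ℝ) ∂ρ :=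
  integral_mono (integrable_min g) hint fun r => by
    simp only
    exact_mod_cast min_le_left _ _

/-- The moment of order `1 + ε` makes the truncation error of order `g ^ (-ε)`. -/
lemma mean_sub_truncMean_le {ε : ℝ} (hε : 0 < ε)
    (hint : Integrable (fun r : ℕ => (r : ℝ) ^ (1 + ε)) ρ) {g : ℕ} (hg : 1 ≤ g) :
    (∫ r : ℕ, (r : ℝ) ∂ρ) - truncMean ρ g ≤
      (∫ r : ℕ, (r : ℝ) ^ (1 + ε) ∂ρ) * (g : ℝ) ^ (-ε) := by
  rw [truncMean, ← integral_sub (integrable_length hε hint) (integrable_min g),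
    ← integral_mul_const]
  refine integral_mono ((integrable_length hε hint).sub (integrable_min g))
    (hint.mul_const _) fun r => ?_
  have hg0 : (0 : ℝ) < g := by exact_mod_cast hg
  simp only
  rcases le_total r g with h | h
  · rw [min_eq_left h, sub_self]
    positivity
  · have hr0 : (0 : ℝ) < r := by exact_mod_cast (hg.trans h)
    rw [min_eq_right h, Real.rpow_add hr0, Real.rpow_one, Real.rpow_neg hg0.le, mul_assoc,
      ← div_eq_mul_inv, ← Real.div_rpow hr0.le hg0.le]
    have h1 : (1 : ℝ) ≤ r / g := (one_le_div hg0).2 (by exact_mod_cast h)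
    have h2 := Real.one_le_rpow h1 hε.le
    nlinarith

end TruncMean

/-! ### The probability that a set of sites is avoided -/

/-- The pairs (length, position) whose arc contains a point of `A`. -/
def hitSet (n : ℕ) (A : Finset ℕ) : Set (ℕ × ZMod n) :=
  {p | ∃ x ∈ A, (x : ZMod n) ∈ arc p.2 p.1}

/-- The law of (length, position) of a single random arc. -/
noncomputable def arcLaw (ρ : Measure ℕ) (n : ℕ) [NeZero n] : Measure (ℕ × ZMod n) :=
  ρ.prod (PMF.uniformOfFintype (ZMod n)).toMeasure

section HitProb

variable {n : ℕ} [NeZero n]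

lemma arcLaw_hitSet (ρ : Measure ℕ) (A : Finset ℕ) : (arcLaw ρ n).real (hitSet n A) =
    ∫ r : ℕ, (Nat.card {u : ZMod n | ∃ x ∈ A, (x : ZMod n) ∈ arc u r} : ℝ) / n ∂ρ := by
  rw [measureReal_def, arcLaw, Measure.prod_apply (MeasurableSet.of_discrete),
    ← integral_toReal Measurable.of_discrete.aemeasurable (.of_forall fun r => measure_lt_top _ _)]
  refine integral_congr_ae (.of_forall fun r => ?_)
  classical
  simp only
  rw [PMF.toMeasure_uniformOfFintype_apply _ MeasurableSet.of_discrete, ZMod.card,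
    ENNReal.toReal_div, ENNReal.toReal_natCast, ENNReal.toReal_natCast, ← Nat.card_eq_fintype_card]
  rfl

variable {ρ : Measure ℕ} [IsProbabilityMeasure ρ]

instance : IsProbabilityMeasure (arcLaw ρ n) := by
  unfold arcLaw; infer_instance

lemma card_div_le_one (A : Finset ℕ) (r : ℕ) :
    (Nat.card {u : ZMod n | ∃ x ∈ A, (x : ZMod n) ∈ arc u r} : ℝ) / n ≤ 1 := by
  refine div_le_one_of_le₀ ?_ (Nat.cast_nonneg _)
  have := Nat.card_le_card_of_injective
    (Subtype.val : {u : ZMod n | ∃ x ∈ A, (x : ZMod n) ∈ arc u r} → ZMod n)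
    Subtype.val_injective
  rw [Nat.card_zmod] at this
  exact_mod_cast this

lemma integrable_card_div (A : Finset ℕ) : Integrable (fun r : ℕ =>
    (Nat.card {u : ZMod n | ∃ x ∈ A, (x : ZMod n) ∈ arc u r} : ℝ) / n) ρ :=
  .of_bound Measurable.of_discrete.aestronglyMeasurable 1 <| .of_forall fun r => by
    rw [Real.norm_of_nonneg (by positivity)]
    exact card_div_le_one A r

lemma sum_truncMean_gap_le {A : Finset ℕ} (hA : A ⊆ Finset.range n) :
    (∑ x ∈ A, truncMean ρ (gap A x)) / n ≤ (arcLaw ρ n).real (hitSet n A) := by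
  simp_rw [arcLaw_hitSet, truncMean]
  rw [← integral_finsetSum _ fun x _ => integrable_min _, ← integral_div]
  refine integral_mono ((integrable_finsetSum _ fun x _ => integrable_min _).div_const _)
    (integrable_card_div A) fun r => ?_
  have := sum_min_gap_le_card hA r
  simp only
  gcongr
  exact_mod_cast this

lemma arcLaw_hitSet_le (hint : Integrable (fun r : ℕ => (r : ℝ)) ρ) (A : Finset ℕ) :
    (arcLaw ρ n).real (hitSet n A) ≤ A.card * (∫ r : ℕ, (r : ℝ) ∂ρ) / n := by
  rw [arcLaw_hitSet, ← integral_const_mul, ← integral_div]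
  refine integral_mono (integrable_card_div A) ((hint.const_mul _).div_const _) fun r => ?_
  have := card_arcs_hitting_le (n := n) A r
  simp only
  gcongr
  exact_mod_cast this

lemma avoid_pow_le_gapProd {A : Finset ℕ} (hA : A ⊆ Finset.range n) (k : ℕ) :
    (1 - (arcLaw ρ n).real (hitSet n A)) ^ k ≤
      gapProd (fun g => Real.exp (-(k / n * truncMean ρ g))) A := by
  have h0 : 0 ≤ 1 - (arcLaw ρ n).real (hitSet n A) := sub_nonneg.2 measureReal_le_one
  refine (pow_le_pow_left₀ h0 (Real.one_sub_le_exp_neg _) k).trans ?_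
  rw [gapProd, ← Real.exp_sum, ← Real.exp_nat_mul, Real.exp_le_exp, Finset.sum_neg_distrib,
    ← Finset.mul_sum, mul_neg, neg_le_neg_iff]
  calc (k : ℝ) / n * ∑ x ∈ A, truncMean ρ (gap A x)
      = k * ((∑ x ∈ A, truncMean ρ (gap A x)) / n) := by ring
    _ ≤ _ := mul_le_mul_of_nonneg_left (sum_truncMean_gap_le hA) (Nat.cast_nonneg _)

end HitProb

section Sequence

variable {Ω : Type*} {n : ℕ} {R : ℕ → Ω → ℕ} {U : ℕ → Ω → ZMod n}

lemma mem_cover {k : ℕ} {ω : Ω} {x : ZMod n} :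
    x ∈ cover R U k ω ↔ ∃ j < k, x ∈ arc (U j ω) (R j ω) := by
  induction k with
  | zero => simp [cover]
  | succ k ih => simp only [cover, mem_union, ih, Nat.lt_succ_iff_lt_or_eq, or_and_right,
      exists_or, exists_eq_left]

lemma cover_mono (R : ℕ → Ω → ℕ) (U : ℕ → Ω → ZMod n) (ω : Ω) :
    Monotone fun k => cover R U k ω := fun _ _ h _ hx =>
  let ⟨j, hj, hxj⟩ := mem_cover.1 hx
  mem_cover.2 ⟨j, hj.trans_le h, hxj⟩

open Classical in
/-- The uncovered sites after `k` arcs, as a subset of `{0, …, n - 1}`. -/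
noncomputable def uncovered (R : ℕ → Ω → ℕ) (U : ℕ → Ω → ZMod n) (k : ℕ) (ω : Ω) : Finset ℕ :=
  (Finset.range n).filter fun x => (x : ZMod n) ∉ cover R U k ω

lemma uncovered_card_eq_zero [NeZero n] {k : ℕ} {ω : Ω} :
    (uncovered R U k ω).card = 0 ↔ cover R U k ω = univ := by
  simp only [Finset.card_eq_zero, Finset.eq_empty_iff_forall_notMem, uncovered,
    Finset.mem_filter, Finset.mem_range, not_and, not_not, eq_univ_iff_forall]
  refine ⟨fun H x => ?_, fun H x _ => H x⟩
  simpa using H x.val (ZMod.val_lt x)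

variable [MeasurableSpace Ω] {P : Measure Ω} {ρ : Measure ℕ} [NeZero n]

lemma IsArcSequence.measurableSet_mem_cover (h : IsArcSequence P ρ R U) (k : ℕ) (x : ZMod n) :
    MeasurableSet {ω | x ∈ cover R U k ω} := by
  have : {ω | x ∈ cover R U k ω} = ⋃ j < k, {ω | x ∈ arc (U j ω) (R j ω)} := by
    ext ω; simp [mem_cover]
  rw [this]
  refine .iUnion fun j => .iUnion fun _ => ?_
  exact ((h.measurable_radius j).prodMk (h.measurable_position j))
    (MeasurableSet.of_discrete (s := {p : ℕ × ZMod n | x ∈ arc p.2 p.1}))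

lemma IsArcSequence.measurableSet_covered (h : IsArcSequence P ρ R U) (k : ℕ) :
    MeasurableSet {ω | cover R U k ω = univ} := by
  have : {ω | cover R U k ω = univ} = ⋂ x, {ω | x ∈ cover R U k ω} := by
    ext ω; simp [eq_univ_iff_forall]
  rw [this]
  exact .iInter fun x => h.measurableSet_mem_cover k x

variable [IsProbabilityMeasure P] [IsProbabilityMeasure ρ]

/-- The first `k` pairs (length, position) are independent with law `arcLaw ρ n`. -/
lemma IsArcSequence.hasLaw_pi (h : IsArcSequence P ρ R U) (k : ℕ) :
    HasLaw (fun ω (j : Fin k) => (R j ω, U j ω)) (Measure.pi fun _ => arcLaw ρ n) P := by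
  have hR : HasLaw (fun ω (j : Fin k) => R j ω) (Measure.pi fun _ => ρ) P :=
    iIndepFun.hasLaw_pi (fun j : Fin k => h.law_radius j) (h.indep_radius.precomp Fin.val_injective)
  have hU : HasLaw (fun ω (j : Fin k) => U j ω)
      (Measure.pi fun _ => (PMF.uniformOfFintype (ZMod n)).toMeasure) P :=
    iIndepFun.hasLaw_pi (fun j : Fin k => h.law_position j)
      (h.indep_position.precomp Fin.val_injective)
  have hind : IndepFun (fun ω (j : Fin k) => R j ω) (fun ω (j : Fin k) => U j ω) P := h.indep.comp
    (φ := fun (f : ℕ → ℕ) (j : Fin k) => f j) (ψ := fun (f : ℕ → ZMod n) (j : Fin k) => f j)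
    (by fun_prop) (by fun_prop)
  have hRU := hind.hasLaw_prod hR hU
  have hmp := MeasurePreserving.symm _ (measurePreserving_arrowProdEquivProdArrow ℕ (ZMod n) (Fin k) (fun _ => ρ)
    (fun _ => (PMF.uniformOfFintype (ZMod n)).toMeasure))
  exact hmp.comp_hasLaw hRU

/-- The sites of `A` all stay uncovered with the `k`-th power of the probability that a single arc
avoids them. -/
lemma IsArcSequence.prob_avoid (h : IsArcSequence P ρ R U) (A : Finset ℕ) (k : ℕ) :
    P.real {ω | ∀ x ∈ A, (x : ZMod n) ∉ cover R U k ω} =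
      (1 - (arcLaw ρ n).real (hitSet n A)) ^ k := by
  have hset : {ω | ∀ x ∈ A, (x : ZMod n) ∉ cover R U k ω} =
      {ω | (fun j : Fin k => (R j ω, U j ω)) ∈ univ.pi fun _ => (hitSet n A)ᶜ} := by
    ext ω
    simp only [mem_ofPred_eq, mem_cover, not_exists, not_and, Set.mem_pi, mem_univ, true_imp_iff,
      mem_compl_iff, hitSet]
    exact ⟨fun H j x hx => H x hx j j.2, fun H x hx j hj => H ⟨j, hj⟩ x hx⟩
  rw [hset, (h.hasLaw_pi k).measureReal_eq (p := fun f => f ∈ univ.pi fun _ => (hitSet n A)ᶜ)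
    (MeasurableSet.univ_pi fun _ => MeasurableSet.of_discrete), measureReal_def]
  simp only [ofPred_mem_eq, Measure.pi_pi, Finset.prod_const, Finset.card_univ, Fintype.card_fin,
    ENNReal.toReal_pow]
  rw [← measureReal_def, probReal_compl_eq_one_sub MeasurableSet.of_discrete]

/-! ### Binomial moments of the number of uncovered sites -/

/-- The `m`-th binomial moment of the number of uncovered sites. -/
lemma IsArcSequence.integral_choose (h : IsArcSequence P ρ R U) (k m : ℕ) :
    Integrable (fun ω => ((uncovered R U k ω).card.choose m : ℝ)) P ∧
    ∫ ω, ((uncovered R U k ω).card.choose m : ℝ) ∂P =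
      ∑ A ∈ Finset.powersetCard m (Finset.range n), (1 - (arcLaw ρ n).real (hitSet n A)) ^ k := by
  classical
  let E : Finset ℕ → Set Ω := fun A => {ω | ∀ x ∈ A, (x : ZMod n) ∉ cover R U k ω}
  have hE : ∀ A, MeasurableSet (E A) := fun A => by
    have : E A = ⋂ x ∈ A, {ω | (x : ZMod n) ∈ cover R U k ω}ᶜ := by
      ext ω; simp [E]
    rw [this]
    exact A.measurableSet_biInter fun x _ => (h.measurableSet_mem_cover k x).compl
  have hsum : (fun ω => ((uncovered R U k ω).card.choose m : ℝ)) = fun ω =>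
      ∑ A ∈ Finset.powersetCard m (Finset.range n), (E A).indicator (fun _ => (1 : ℝ)) ω := by
    funext ω
    rw [← Finset.card_powersetCard]
    simp only [indicator_apply]
    rw [Finset.sum_boole]
    congr 2
    ext A
    simp only [uncovered, Finset.mem_powersetCard, Finset.mem_filter, E, mem_ofPred_eq]
    constructor
    · rintro ⟨h1, h2⟩
      exact ⟨⟨fun x hx => (Finset.mem_filter.1 (h1 hx)).1, h2⟩,
        fun x hx => (Finset.mem_filter.1 (h1 hx)).2⟩
    · rintro ⟨⟨h1, h2⟩, h3⟩
      exact ⟨fun x hx => Finset.mem_filter.2 ⟨h1 hx, h3 x hx⟩, h2⟩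
  have hint : ∀ A, Integrable ((E A).indicator fun _ => (1 : ℝ)) P := fun A =>
    (integrable_const 1).indicator (hE A)
  rw [hsum]
  refine ⟨integrable_finsetSum _ fun A _ => hint A, ?_⟩
  rw [integral_finsetSum _ fun A _ => hint A]
  refine Finset.sum_congr rfl fun A _ => ?_
  rw [integral_indicator_const _ (hE A), smul_eq_mul, mul_one]
  exact h.prob_avoid A k

lemma alternating_sum_choose_le (N M : ℕ) :
    ∑ j ∈ Finset.range (2 * M), (-1 : ℝ) ^ j * N.choose j ≤ if N = 0 then 1 else 0 := by
  rcases M with _ | M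
  · simp only [mul_zero, Finset.range_zero, Finset.sum_empty]
    positivity
  · rcases N with _ | N
    · rw [show 2 * (M + 1) = 2 * M + 1 + 1 by ring, Finset.sum_range_succ']
      simp
    · have := congrArg (Int.cast (R := ℝ))
        (Int.alternating_sum_range_choose_eq_choose (n := N) (m := 2 * M + 1))
      push_cast at this
      rw [show 2 * (M + 1) = 2 * M + 1 + 1 by ring, this, pow_succ, pow_mul]
      simp

lemma le_alternating_sum_choose (N M : ℕ) :
    (if N = 0 then 1 else 0) ≤ ∑ j ∈ Finset.range (2 * M + 1), (-1 : ℝ) ^ j * N.choose j := by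
  rcases N with _ | N
  · rw [Finset.sum_range_succ']
    simp
  · have := congrArg (Int.cast (R := ℝ))
      (Int.alternating_sum_range_choose_eq_choose (n := N) (m := 2 * M))
    push_cast at this
    rw [this, pow_mul]
    simp

/-- The Bonferroni inequalities for the event that no site is uncovered. -/
lemma IsArcSequence.bonferroni (h : IsArcSequence P ρ R U) (k M : ℕ) :
    ∑ j ∈ Finset.range (2 * M), (-1 : ℝ) ^ j *
        ∑ A ∈ Finset.powersetCard j (Finset.range n), (1 - (arcLaw ρ n).real (hitSet n A)) ^ k ≤
      P.real {ω | cover R U k ω = univ} ∧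
    P.real {ω | cover R U k ω = univ} ≤ ∑ j ∈ Finset.range (2 * M + 1), (-1 : ℝ) ^ j *
        ∑ A ∈ Finset.powersetCard j (Finset.range n),
          (1 - (arcLaw ρ n).real (hitSet n A)) ^ k := by
  have hP : P.real {ω | cover R U k ω = univ} =
      ∫ ω, (if (uncovered R U k ω).card = 0 then 1 else 0 : ℝ) ∂P := by
    have := integral_indicator_const (μ := P) (1 : ℝ) (h.measurableSet_covered k)
    rw [smul_eq_mul, mul_one] at this
    rw [← this]
    refine integral_congr_ae (.of_forall fun ω => ?_)
    simp only [uncovered_card_eq_zero]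
    by_cases hc : cover R U k ω = univ <;> simp [hc]
  have hI : Integrable (fun ω => (if (uncovered R U k ω).card = 0 then 1 else 0 : ℝ)) P := by
    refine ((integrable_const (1 : ℝ)).indicator (h.measurableSet_covered k)).congr
      (.of_forall fun ω => ?_)
    simp only [uncovered_card_eq_zero]
    by_cases hc : cover R U k ω = univ <;> simp [hc]
  have hS : ∀ K, ∑ j ∈ Finset.range K, (-1 : ℝ) ^ j *
        ∑ A ∈ Finset.powersetCard j (Finset.range n), (1 - (arcLaw ρ n).real (hitSet n A)) ^ k =
      ∫ ω, ∑ j ∈ Finset.range K, (-1 : ℝ) ^ j * ((uncovered R U k ω).card.choose j : ℝ) ∂P :=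
    fun K => by
      rw [integral_finsetSum _ fun j _ => (h.integral_choose k j).1.const_mul _]
      refine Finset.sum_congr rfl fun j _ => ?_
      rw [integral_const_mul, (h.integral_choose k j).2]
  have hSI : ∀ K, Integrable (fun ω => ∑ j ∈ Finset.range K,
      (-1 : ℝ) ^ j * ((uncovered R U k ω).card.choose j : ℝ)) P := fun K =>
    integrable_finsetSum _ fun j _ => (h.integral_choose k j).1.const_mul _
  rw [hP, hS, hS]
  exact ⟨integral_mono (hSI _) hI fun ω => alternating_sum_choose_le _ M,
    integral_mono hI (hSI _) fun ω => le_alternating_sum_choose _ M⟩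

end Sequence

/-! ### The probability that the torus is covered -/

/-- If `μ k / n - log n → s`, then `k` arcs cover the torus `ℤ/nℤ` with probability tending to
`exp (-exp (-s))`. -/
theorem tendsto_prob_covered {ρ : Measure ℕ} [IsProbabilityMeasure ρ] (hρ : ∀ᵐ r ∂ρ, 1 ≤ r)
    {ε : ℝ} (hε : 0 < ε) (hint : Integrable (fun r : ℕ => (r : ℝ) ^ (1 + ε)) ρ)
    {μ : ℝ} (hμ : μ = ∫ r : ℕ, (r : ℝ) ∂ρ)
    {Ω : ℕ+ → Type*} [∀ n, MeasurableSpace (Ω n)]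
    {P : ∀ n, Measure (Ω n)} [∀ n, IsProbabilityMeasure (P n)]
    {R : ∀ n, ℕ → Ω n → ℕ} {U : ∀ n : ℕ+, ℕ → Ω n → ZMod n}
    (hRU : ∀ n, IsArcSequence (P n) ρ (R n) (U n)) {k : ℕ+ → ℕ} {s : ℝ}
    (hk : Tendsto (fun n : ℕ+ => μ * k n / n - Real.log n) atTop (𝓝 s)) :
    Tendsto (fun n => (P n).real {ω | cover (R n) (U n) (k n) ω = univ}) atTop
      (𝓝 (Real.exp (-Real.exp (-s)))) := by
  have hlen := integrable_length hε hint
  have hle : ∀ g, truncMean ρ g ≤ μ := fun g => hμ ▸ truncMean_le hlen g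
  have hμ0 : 0 < μ := one_pos.trans_le ((one_le_truncMean hρ le_rfl).trans (hle 1))
  have hn : Tendsto (fun n : ℕ+ => (n : ℕ)) atTop atTop := tendsto_PNat_val_atTop_atTop
  refine tendsto_of_bonferroni (S := fun m (n : ℕ+) => ∑ A ∈ Finset.powersetCard m (Finset.range n),
    (1 - (arcLaw ρ n).real (hitSet n A)) ^ k n) (fun m => ?_)
    (fun M => .of_forall fun n : ℕ+ => ((hRU n).bonferroni (k n) M).1)
    (fun M => .of_forall fun n : ℕ+ => ((hRU n).bonferroni (k n) M).2)
  obtain ⟨L, hL, hL'⟩ := exists_tendsto_le_choose_mul_pow hμ0 hn hk m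
  obtain ⟨B, hB, hB'⟩ := exists_tendsto_sum_gapProd_le hμ0 hε
    (integral_nonneg fun r => Real.rpow_nonneg (Nat.cast_nonneg r) (1 + ε))
    (truncMean_mono (ρ := ρ)) (fun g hg => one_le_truncMean hρ hg) hle
    (fun g hg => hμ ▸ mean_sub_truncMean_le hε hint hg) hn hk m
  refine tendsto_of_tendsto_of_tendsto_of_le_of_le' hL hB ?_ ?_
  · filter_upwards [hL'] with n hnL
    refine hnL.2.trans ?_
    rw [← nsmul_eq_mul]
    refine le_trans (le_of_eq ?_)
      (Finset.card_nsmul_le_sum _ _ ((1 - m * μ / n) ^ k n) fun A hA => ?_)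
    · simp
    · refine pow_le_pow_left₀ (sub_nonneg.2 hnL.1) (sub_le_sub_left ?_ _) _
      rw [← (Finset.mem_powersetCard.1 hA).2, hμ]
      exact arcLaw_hitSet_le hlen A
  · refine .of_forall fun n => le_trans (Finset.sum_le_sum fun A hA => ?_) (hB' n)
    exact avoid_pow_le_gapProd (Finset.mem_powersetCard.1 hA).1 (k n)

/-! ### Chebyshev's inequality for the Poisson distribution -/

/-- The variance of the Poisson distribution with parameter `t` is `t`, written as a sum. -/
lemma hasSum_sq_sub_poisson (t : ℝ≥0) :
    HasSum (fun k : ℕ => (Real.exp (-t) * t ^ k / k.factorial) • ((k : ℝ) - t) ^ 2) t := by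
  have h0 := hasSum_one_poissonMeasure t
  have h1 : HasSum (fun k : ℕ => (Real.exp (-t) * (t : ℝ) ^ k / k.factorial) * k) t := by
    rw [← hasSum_nat_add_iff' 1]
    simp only [Finset.range_one, Finset.sum_singleton, Nat.cast_zero, mul_zero, sub_zero]
    have := h0.mul_left (t : ℝ)
    rw [mul_one] at this
    refine this.congr_fun fun k => ?_
    rw [Nat.factorial_succ, pow_succ]
    push_cast
    field_simp
  have h2 : HasSum (fun k : ℕ => (Real.exp (-t) * (t : ℝ) ^ k / k.factorial) * (k * (k - 1)))
      ((t : ℝ) ^ 2) := by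
    rw [← hasSum_nat_add_iff' 1]
    simp only [Finset.range_one, Finset.sum_singleton, Nat.cast_zero, mul_zero, sub_zero, zero_mul]
    have := h1.mul_left (t : ℝ)
    rw [← sq] at this
    refine this.congr_fun fun k => ?_
    rw [Nat.factorial_succ, pow_succ]
    push_cast
    field_simp
    ring
  have h := (h2.add (h1.mul_left (1 - 2 * (t : ℝ)))).add (h0.mul_left ((t : ℝ) ^ 2))
  have e : (t : ℝ) ^ 2 + (1 - 2 * t) * t + t ^ 2 * 1 = t := by ring
  rw [e] at h
  refine h.congr_fun fun k => ?_
  rw [smul_eq_mul]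
  ring

lemma poissonMeasure_abs_sub_ge_le (t : ℝ≥0) {c : ℝ} (hc : 0 < c) :
    (poissonMeasure t).real {k : ℕ | c ≤ |(k : ℝ) - t|} ≤ t / c ^ 2 := by
  have hint : Integrable (fun k : ℕ => ((k : ℝ) - t) ^ 2) (poissonMeasure t) := by
    rw [integrable_poissonMeasure_iff]
    refine (hasSum_sq_sub_poisson t).summable.congr fun k => ?_
    rw [Real.norm_of_nonneg (sq_nonneg _)]
    rfl
  have h1 := mul_meas_ge_le_integral_of_nonneg (.of_forall fun k => sq_nonneg _) hint (c ^ 2)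
  rw [integral_poissonMeasure, (hasSum_sq_sub_poisson t).tsum_eq] at h1
  rw [le_div_iff₀' (by positivity)]
  refine le_trans (le_of_eq ?_) h1
  congr 3
  ext k
  rw [← sq_abs ((k : ℝ) - t)]
  exact (pow_le_pow_iff_left₀ hc.le (abs_nonneg _) two_ne_zero).symm

/-! ### Convergence in distribution to the Gumbel law -/

/-- Convergence of the distribution functions implies convergence in distribution. -/
lemma tendstoInDistribution_gumbel {ι : Type*} {l : Filter ι} [l.IsCountablyGenerated]
    {Ω : ι → Type*} [∀ i, MeasurableSpace (Ω i)] {P : ∀ i, Measure (Ω i)}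
    [∀ i, IsProbabilityMeasure (P i)] {X : ∀ i, Ω i → ℝ} (hX : ∀ i, AEMeasurable (X i) (P i))
    (h : ∀ s, Tendsto (fun i => (P i).real {ω | X i ω ≤ s}) l (𝓝 (Real.exp (-Real.exp (-s))))) :
    TendstoInDistribution X l id P gumbel where
  forall_aemeasurable := hX
  aemeasurable_limit := aemeasurable_id
  tendsto := by
    refine (isPiSystem_Ioc (id : ℝ → ℝ) id).tendsto_probabilityMeasure_of_tendsto_of_mem
      ?_ ?_ ?_
    · rintro _ ⟨a, b, -, rfl⟩
      exact measurableSet_Ioc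
    · intro u hu x hx
      obtain ⟨δ, hδ, hsub⟩ := Metric.isOpen_iff.1 hu x hx
      refine ⟨Ioc (x - δ / 2) (x + δ / 2), ⟨x - δ / 2, x + δ / 2, by simp only [id]; linarith, rfl⟩,
        Ioc_mem_nhds (by linarith) (by linarith), fun y hy => hsub ?_⟩
      rw [Metric.mem_ball, Real.dist_eq, abs_lt]
      constructor <;> linarith [hy.1, hy.2]
    · rintro _ ⟨a, b, hab, rfl⟩
      rw [← NNReal.tendsto_coe]
      have hab' : Iic a ⊆ Iic b := Iic_subset_Iic.2 hab.le
      have hIoc : ∀ ν : Measure ℝ, [IsProbabilityMeasure ν] →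
          ν.real (Ioc a b) = ν.real (Iic b) - ν.real (Iic a) := fun ν _ => by
        rw [← Iic_sdiff_Iic, measureReal_sdiff hab' measurableSet_Iic]
      have hl : ∀ i c, ((P i).map (X i)).real (Iic c) = (P i).real {ω | X i ω ≤ c} := fun i c =>
        map_measureReal_apply_of_aemeasurable (hX i) measurableSet_Iic
      have hg : gumbel.real (Ioc a b) = Real.exp (-Real.exp (-b)) - Real.exp (-Real.exp (-a)) := by
        rw [measureReal_def, gumbel, StieltjesFunction.measure_Ioc, ENNReal.toReal_ofReal]
        · rfl
        · exact sub_nonneg.2 (gumbelCDF.mono hab.le)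
      have := (h b).sub (h a)
      rw [← hg] at this
      have hmap : gumbel.map id = gumbel := Measure.map_id
      simp only [hmap]
      refine this.congr fun i => ?_
      have := Measure.isProbabilityMeasure_map (hX i)
      rw [← hl, ← hl, ← hIoc]
      rfl

/-! ### The time scale -/

/-- The number of arcs, `(n / μ) (log n + s)` rounded down, at which the probability that the torus
is covered is close to `exp (-exp (-s))`. -/
noncomputable def scale (μ s : ℝ) (n : ℕ) : ℕ := ⌊(n : ℝ) / μ * (Real.log n + s)⌋₊

lemma eventually_log_add_pos (s : ℝ) :
    ∀ᶠ n : ℕ+ in atTop, 0 < Real.log n + s :=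
  ((tendsto_atTop_add_const_right _ s (Real.tendsto_log_atTop.comp
    tendsto_natCast_atTop_atTop)).comp tendsto_PNat_val_atTop_atTop).eventually_gt_atTop 0

lemma tendsto_scale {μ : ℝ} (hμ : 0 < μ) (s : ℝ) :
    Tendsto (fun n : ℕ+ => μ * scale μ s n / n - Real.log n) atTop (𝓝 s) := by
  have hn : Tendsto (fun n : ℕ+ => (n : ℝ)) atTop atTop :=
    tendsto_natCast_atTop_atTop.comp tendsto_PNat_val_atTop_atTop
  have h1 : Tendsto (fun n : ℕ+ => s - μ / n) atTop (𝓝 (s - 0)) :=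
    tendsto_const_nhds.sub (tendsto_const_nhds.div_atTop hn)
  rw [sub_zero] at h1
  refine tendsto_of_tendsto_of_tendsto_of_le_of_le' h1 tendsto_const_nhds ?_ ?_
  · refine .of_forall fun n => ?_
    have hn0 : (0 : ℝ) < n := by exact_mod_cast n.pos
    have h2 := (Nat.lt_floor_add_one ((n : ℝ) / μ * (Real.log n + s))).le
    have h3 := mul_le_mul_of_nonneg_left h2 (div_pos hμ hn0).le
    have h4 : μ / n * ((n : ℝ) / μ * (Real.log n + s)) = Real.log n + s := by field_simp
    have h5 : μ / n * ((scale μ s n : ℝ) + 1) = μ * scale μ s n / n + μ / n := by ring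
    rw [h4] at h3
    unfold scale at *
    linarith
  · filter_upwards [eventually_log_add_pos s] with n hs
    have hn0 : (0 : ℝ) < n := by exact_mod_cast n.pos
    have h2 := Nat.floor_le (by positivity : 0 ≤ (n : ℝ) / μ * (Real.log n + s))
    have h3 := mul_le_mul_of_nonneg_left h2 (div_pos hμ hn0).le
    have h4 : μ / n * ((n : ℝ) / μ * (Real.log n + s)) = Real.log n + s := by field_simp
    have h5 : μ / n * (scale μ s n : ℝ) = μ * scale μ s n / n := by ring
    rw [h4] at h3
    unfold scale at *
    linarith

lemma mul_sub_log_le_iff {μ s x : ℝ} (hμ : 0 < μ) (n : ℕ+) :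
    μ / (n : ℝ) * x - Real.log n ≤ s ↔ x ≤ (n : ℝ) / μ * (Real.log n + s) := by
  have hn0 : (0 : ℝ) < n := by exact_mod_cast n.pos
  rw [sub_le_iff_le_add', ← le_div_iff₀' (by positivity)]
  have : (Real.log n + s) / (μ / n) = (n : ℝ) / μ * (Real.log n + s) := by field_simp
  rw [this]

/-! ### The discrete cover time -/

section Sequence

variable {Ω : Type*} {n : ℕ} {R : ℕ → Ω → ℕ} {U : ℕ → Ω → ZMod n}

lemma discreteCoverTime_le_iff {ω : Ω} (hω : ∃ k, cover R U k ω = univ) {k : ℕ} :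
    discreteCoverTime R U ω ≤ k ↔ cover R U k ω = univ := by
  refine ⟨fun hk => ?_, fun hk => Nat.sInf_le hk⟩
  have h1 : cover R U (discreteCoverTime R U ω) ω = univ := Nat.sInf_mem (s := {k | cover R U k ω = univ}) hω
  exact univ_subset_iff.1 (h1 ▸ cover_mono R U ω hk)

variable [MeasurableSpace Ω] {P : Measure Ω} {ρ : Measure ℕ} {N : ℝ≥0 → Ω → ℕ}

lemma IsArcSequence.measurable_discreteCoverTime [NeZero n] (h : IsArcSequence P ρ R U) :
    Measurable (discreteCoverTime R U) := by
  refine measurable_of_Iic fun k => ?_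
  -- the infimum of the empty set is `0`
  have : discreteCoverTime R U ⁻¹' Iic k =
      {ω | cover R U k ω = univ} ∪ ⋂ j, {ω | cover R U j ω = univ}ᶜ := by
    ext ω
    simp only [mem_preimage, mem_Iic, mem_union, mem_iInter, mem_compl_iff, mem_ofPred_eq]
    by_cases hω : ∃ k, cover R U k ω = univ
    · rw [discreteCoverTime_le_iff hω]
      exact ⟨Or.inl, fun H => H.resolve_right fun H => hω.elim H⟩
    · have h0 : discreteCoverTime R U ω = 0 :=
        Nat.sInf_eq_zero.2 (Or.inr (eq_empty_of_forall_notMem fun j hj => hω ⟨j, hj⟩))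
      rw [h0]
      exact iff_of_true (Nat.zero_le _) (Or.inr fun j hj => hω ⟨j, hj⟩)
  rw [this]
  exact (h.measurableSet_covered k).union
    (.iInter fun j => (h.measurableSet_covered j).compl)

/-- A given site is missed by `k` arcs with probability `(1 - p) ^ k`, where `p > 0`. -/
lemma IsArcSequence.ae_exists_covered [NeZero n] [IsProbabilityMeasure P]
    [IsProbabilityMeasure ρ] (h : IsArcSequence P ρ R U) (hρ : ∀ᵐ r ∂ρ, 1 ≤ r) :
    ∀ᵐ ω ∂P, ∃ k, cover R U k ω = univ := by
  have hn : (0 : ℝ) < n := by exact_mod_cast NeZero.pos n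
  have hx : ∀ x : ZMod n, ∀ᵐ ω ∂P, ∃ k, x ∈ cover R U k ω := fun x => by
    set A : Finset ℕ := {x.val} with hA
    have hp : 0 < (arcLaw ρ n).real (hitSet n A) := by
      have h1 := sum_truncMean_gap_le (ρ := ρ) (n := n) (A := A)
        (by simpa [hA] using ZMod.val_lt x)
      refine lt_of_lt_of_le ?_ h1
      rw [hA, Finset.sum_singleton]
      exact div_pos (one_pos.trans_le (one_le_truncMean hρ (one_le_gap _ _))) hn
    have hlim := tendsto_pow_atTop_nhds_zero_of_lt_one
      (sub_nonneg.2 (measureReal_le_one (μ := arcLaw ρ n) (s := hitSet n A))) (by linarith)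
    rw [ae_iff, ← measureReal_eq_zero_iff]
    refine le_antisymm (ge_of_tendsto' hlim fun k => ?_) measureReal_nonneg
    rw [← h.prob_avoid A k]
    refine measureReal_mono fun ω hω => ?_
    simp only [not_exists, mem_ofPred_eq] at hω
    simpa [hA] using hω k
  filter_upwards [ae_all_iff.2 hx] with ω hω
  choose k hk using hω
  refine ⟨Finset.univ.sup k, eq_univ_of_forall fun x => ?_⟩
  exact cover_mono R U ω (Finset.le_sup (Finset.mem_univ x)) (hk x)

/-! ### The continuous cover time -/

lemma IsArcSequence.measurableSet_contCovered [NeZero n] (h : IsArcSequence P ρ R U)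
    (hN : IsUnitPoissonProcess P N) (t : ℝ≥0) :
    MeasurableSet {ω | contCover R U N t ω = univ} := by
  have : {ω | contCover R U N t ω = univ} =
      ⋃ j, N t ⁻¹' {j} ∩ {ω | cover R U j ω = univ} := by
    ext ω
    simp [contCover]
  rw [this]
  exact .iUnion fun j => (hN.measurable t (measurableSet_singleton j)).inter
    (h.measurableSet_covered j)

lemma IsUnitPoissonProcess.hasLaw (hN : IsUnitPoissonProcess P N) (t : ℝ≥0) :
    HasLaw (N t) (poissonMeasure t) P := by
  have h1 := hN.law_increment 0 t t.2
  rw [tsub_zero] at h1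
  refine h1.congr ?_
  filter_upwards [hN.zero] with ω hω
  rw [hω, Nat.sub_zero]

lemma IsUnitPoissonProcess.prob_abs_sub_ge_le (hN : IsUnitPoissonProcess P N) (t : ℝ≥0) {c : ℝ}
    (hc : 0 < c) : P.real {ω | c ≤ |(N t ω : ℝ) - t|} ≤ t / c ^ 2 := by
  rw [(hN.hasLaw t).measureReal_eq (p := fun k : ℕ => c ≤ |(k : ℝ) - t|)
    MeasurableSet.of_discrete]
  exact poissonMeasure_abs_sub_ge_le t hc

variable [IsProbabilityMeasure P]

lemma IsUnitPoissonProcess.ae_exists_ge (hN : IsUnitPoissonProcess P N) :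
    ∀ᵐ ω ∂P, ∀ k, ∃ t, k ≤ N t ω := by
  rw [ae_all_iff]
  intro k
  have hlim : Tendsto (fun j : ℕ => 4 / (j : ℝ)) atTop (𝓝 0) :=
    tendsto_const_nhds.div_atTop tendsto_natCast_atTop_atTop
  rw [ae_iff, ← measureReal_eq_zero_iff]
  refine le_antisymm (ge_of_tendsto hlim ?_) measureReal_nonneg
  filter_upwards [eventually_ge_atTop (2 * k + 1)] with j hj
  have hj' : 2 * (k : ℝ) + 1 ≤ j := by exact_mod_cast hj
  have hk0 : (0 : ℝ) ≤ k := Nat.cast_nonneg k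
  have hj0 : (0 : ℝ) < j := by linarith
  refine le_trans ?_ ((hN.prob_abs_sub_ge_le j (c := j / 2) (by positivity)).trans_eq ?_)
  · refine measureReal_mono fun ω hω => ?_
    simp only [not_exists, not_le, mem_ofPred_eq] at hω ⊢
    have h1 : (N j ω : ℝ) < k := by exact_mod_cast hω j
    rw [NNReal.coe_natCast, le_abs]
    right
    linarith
  · rw [NNReal.coe_natCast]
    field_simp
    norm_num

/-- The comparison of the two models, through the fluctuations of the number of arcs at time `t`. -/
lemma IsUnitPoissonProcess.prob_contCovered_bounds
    (hN : IsUnitPoissonProcess P N) {t : ℝ≥0} {c : ℝ} (hc : 0 < c) {a b : ℕ}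
    (ha : (a : ℝ) ≤ t - c) (hb : ∀ j : ℕ, (j : ℝ) ≤ t + c → j ≤ b) :
    P.real {ω | cover R U a ω = univ} - t / c ^ 2 ≤ P.real {ω | contCover R U N t ω = univ} ∧
    P.real {ω | contCover R U N t ω = univ} ≤ P.real {ω | cover R U b ω = univ} + t / c ^ 2 := by
  have hcheb := hN.prob_abs_sub_ge_le t hc
  constructor
  · have h1 : P.real {ω | cover R U a ω = univ} ≤
        P.real ({ω | contCover R U N t ω = univ} ∪ {ω | c ≤ |(N t ω : ℝ) - t|}) := by
      refine measureReal_mono fun ω hω => ?_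
      by_cases hd : c ≤ |(N t ω : ℝ) - t|
      · exact Or.inr hd
      · have h2 := (abs_lt.1 (not_le.1 hd)).1
        have h3 : a ≤ N t ω := by exact_mod_cast (by linarith : (a : ℝ) ≤ N t ω)
        have h4 : cover R U a ω = univ := hω
        exact Or.inl (univ_subset_iff.1 (h4 ▸ cover_mono R U ω h3))
    linarith [measureReal_union_le (μ := P) {ω | contCover R U N t ω = univ}
      {ω | c ≤ |(N t ω : ℝ) - t|}]
  · have h1 : P.real {ω | contCover R U N t ω = univ} ≤
        P.real ({ω | cover R U b ω = univ} ∪ {ω | c ≤ |(N t ω : ℝ) - t|}) := by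
      refine measureReal_mono fun ω hω => ?_
      by_cases hd : c ≤ |(N t ω : ℝ) - t|
      · exact Or.inr hd
      · have h2 := (abs_lt.1 (not_le.1 hd)).2
        have h3 : N t ω ≤ b := hb _ (by linarith)
        have h4 : cover R U (N t ω) ω = univ := hω
        exact Or.inl (univ_subset_iff.1 (h4 ▸ cover_mono R U ω h3))
    linarith [measureReal_union_le (μ := P) {ω | cover R U b ω = univ}
      {ω | c ≤ |(N t ω : ℝ) - t|}]

variable [NeZero n] [IsProbabilityMeasure ρ]

lemma IsArcSequence.ae_exists_contCovered (h : IsArcSequence P ρ R U) (hρ : ∀ᵐ r ∂ρ, 1 ≤ r)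
    (hN : IsUnitPoissonProcess P N) : ∀ᵐ ω ∂P, ∃ t, contCover R U N t ω = univ := by
  filter_upwards [h.ae_exists_covered hρ, hN.ae_exists_ge] with ω ⟨k, hk⟩ hω
  obtain ⟨t, ht⟩ := hω k
  exact ⟨t, univ_subset_iff.1 (hk ▸ cover_mono R U ω ht)⟩

/-- Since the paths are nondecreasing and right-continuous, the torus is covered at time `t` if and
only if the cover time is at most `t`. -/
lemma IsArcSequence.ae_contCoverTime_le_iff (h : IsArcSequence P ρ R U) (hρ : ∀ᵐ r ∂ρ, 1 ≤ r)
    (hN : IsUnitPoissonProcess P N) :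
    ∀ᵐ ω ∂P, ∀ t, contCoverTime R U N ω ≤ t ↔ contCover R U N t ω = univ := by
  filter_upwards [h.ae_exists_contCovered hρ hN, hN.mono, hN.rightCont] with ω hne hmono hright t
  refine ⟨fun ht => ?_, fun ht => csInf_le (OrderBot.bddBelow _) ht⟩
  have hup : ∀ s, contCover R U N s ω = univ → ∀ u, N s ω ≤ N u ω →
      contCover R U N u ω = univ := fun s hs u hsu =>
    univ_subset_iff.1 (hs ▸ cover_mono R U ω hsu)
  have hev : ∀ᶠ s in 𝓝[≥] t, N s ω = N t ω := by
    have := hright t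
    rwa [ContinuousWithinAt, nhds_discrete, tendsto_pure] at this
  obtain ⟨u, htu, hu⟩ := (mem_nhdsGE_iff_exists_Ico_subset' (lt_add_one t)).1 hev
  obtain ⟨s, hs, hsu⟩ := exists_lt_of_csInf_lt (s := {t | contCover R U N t ω = univ}) hne
    (ht.trans_lt htu)
  refine hup s hs t ?_
  rcases le_total s t with hst | hts
  · exact hmono hst
  · exact (hu ⟨hts, hsu⟩ : N s ω = N t ω).le

lemma IsArcSequence.aemeasurable_contCoverTime (h : IsArcSequence P ρ R U)
    (hρ : ∀ᵐ r ∂ρ, 1 ≤ r) (hN : IsUnitPoissonProcess P N) :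
    AEMeasurable (contCoverTime R U N) P := by
  obtain ⟨G, hG, hGm, hGs⟩ := (h.ae_contCoverTime_le_iff hρ hN).exists_measurable_mem
  refine ⟨G.indicator (contCoverTime R U N), measurable_of_Iic fun t => ?_, ?_⟩
  · have : G.indicator (contCoverTime R U N) ⁻¹' Iic t =
        (G ∩ {ω | contCover R U N t ω = univ}) ∪ Gᶜ := by
      ext ω
      by_cases hω : ω ∈ G
      · simp [hω, hGs ω hω t]
      · simp [hω]
    rw [this]
    exact (hGm.inter (h.measurableSet_contCovered hN t)).union hGm.compl
  · filter_upwards [hG] with ω hω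
    rw [indicator_of_mem hω]

end Sequence

/-! ### Limits of the distribution functions -/

section Limit

variable {ρ : Measure ℕ} [IsProbabilityMeasure ρ] {μ ε : ℝ}
  {Ω : ℕ+ → Type*} [∀ n, MeasurableSpace (Ω n)]
  {P : ∀ n, Measure (Ω n)} [∀ n, IsProbabilityMeasure (P n)]
  {R : ∀ n, ℕ → Ω n → ℕ} {U : ∀ n : ℕ+, ℕ → Ω n → ZMod n}

lemma mean_pos (hρ : ∀ᵐ r ∂ρ, 1 ≤ r) (hε : 0 < ε)
    (hint : Integrable (fun r : ℕ => (r : ℝ) ^ (1 + ε)) ρ) : 0 < ∫ r : ℕ, (r : ℝ) ∂ρ :=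
  one_pos.trans_le ((one_le_truncMean hρ le_rfl).trans (truncMean_le (integrable_length hε hint) 1))

lemma tendsto_cdf_discreteCoverTime (hρ : ∀ᵐ r ∂ρ, 1 ≤ r) (hε : 0 < ε)
    (hint : Integrable (fun r : ℕ => (r : ℝ) ^ (1 + ε)) ρ) (hμ : μ = ∫ r : ℕ, (r : ℝ) ∂ρ)
    (hRU : ∀ n, IsArcSequence (P n) ρ (R n) (U n)) (s : ℝ) :
    Tendsto (fun n : ℕ+ => (P n).real
      {ω | μ / (n : ℝ) * (discreteCoverTime (R n) (U n) ω : ℝ) - Real.log n ≤ s}) atTop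
      (𝓝 (Real.exp (-Real.exp (-s)))) := by
  have hμ0 : 0 < μ := hμ ▸ mean_pos hρ hε hint
  refine (tendsto_prob_covered hρ hε hint hμ hRU (tendsto_scale hμ0 s)).congr' ?_
  filter_upwards [eventually_log_add_pos s] with n hs
  refine measureReal_congr ?_
  filter_upwards [(hRU n).ae_exists_covered hρ] with ω hω
  have hn0 : (0 : ℝ) < n := by exact_mod_cast n.pos
  refine propext (?_ : cover (R n) (U n) (scale μ s n) ω = univ ↔ _ ≤ s)
  rw [mul_sub_log_le_iff hμ0, ← discreteCoverTime_le_iff hω, scale, Nat.le_floor_iff (by positivity)]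

/-- The number of arcs at time `(n / μ) (log n + s)` is within `(n / μ) δ` of this time with
probability tending to `1`, so the distribution function at `s` lies asymptotically between the
limits for the discrete process at `s - δ` and `s + δ`. -/
lemma tendsto_cdf_contCoverTime (hρ : ∀ᵐ r ∂ρ, 1 ≤ r) (hε : 0 < ε)
    (hint : Integrable (fun r : ℕ => (r : ℝ) ^ (1 + ε)) ρ) (hμ : μ = ∫ r : ℕ, (r : ℝ) ∂ρ)
    (hRU : ∀ n, IsArcSequence (P n) ρ (R n) (U n)) {N : ∀ n, ℝ≥0 → Ω n → ℕ}
    (hN : ∀ n, IsUnitPoissonProcess (P n) (N n)) (s : ℝ) :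
    Tendsto (fun n : ℕ+ => (P n).real
      {ω | μ / (n : ℝ) * (contCoverTime (R n) (U n) (N n) ω : ℝ) - Real.log n ≤ s}) atTop
      (𝓝 (Real.exp (-Real.exp (-s)))) := by
  have hμ0 : 0 < μ := hμ ▸ mean_pos hρ hε hint
  let t : ℕ+ → ℝ≥0 := fun n => ((n : ℝ) / μ * (Real.log n + s)).toNNReal
  have hev : ∀ᶠ n : ℕ+ in atTop, (t n : ℝ) = (n : ℝ) / μ * (Real.log n + s) := by
    filter_upwards [eventually_log_add_pos s] with n hs
    exact Real.coe_toNNReal _ (by positivity)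
  have hcdf : ∀ᶠ n : ℕ+ in atTop,
      (P n).real {ω | contCover (R n) (U n) (N n) (t n) ω = univ} = (P n).real
        {ω | μ / (n : ℝ) * (contCoverTime (R n) (U n) (N n) ω : ℝ) - Real.log n ≤ s} := by
    filter_upwards [hev] with n ht
    refine measureReal_congr ?_
    filter_upwards [(hRU n).ae_contCoverTime_le_iff hρ (hN n)] with ω hω
    refine propext (?_ : contCover (R n) (U n) (N n) (t n) ω = univ ↔ _ ≤ s)
    rw [mul_sub_log_le_iff hμ0, ← hω, ← ht, NNReal.coe_le_coe]
  refine Tendsto.congr' hcdf ?_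
  have hlim : ∀ u, Tendsto
      (fun n => (P n).real {ω | cover (R n) (U n) (scale μ u n) ω = univ}) atTop
      (𝓝 (Real.exp (-Real.exp (-u)))) := fun u =>
    tendsto_prob_covered hρ hε hint hμ hRU (tendsto_scale hμ0 u)
  -- The variance of the number of arcs is of order `n log n`, the square of the window of order
  -- `n ^ 2`.
  have hvar : ∀ δ : ℝ, Tendsto (fun n : ℕ+ => (t n : ℝ) / (n / μ * δ) ^ 2) atTop (𝓝 0) :=
      fun δ => by
    have hn : Tendsto (fun n : ℕ+ => (n : ℝ)) atTop atTop :=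
      tendsto_natCast_atTop_atTop.comp tendsto_PNat_val_atTop_atTop
    have h1 : Tendsto (fun n : ℕ+ => Real.log n / (n : ℝ) + s / n) atTop (𝓝 (0 + 0)) :=
      (Real.isLittleO_log_id_atTop.tendsto_div_nhds_zero.comp hn).add
        (tendsto_const_nhds.div_atTop hn)
    have h2 := h1.mul_const (μ / δ ^ 2)
    rw [add_zero, zero_mul] at h2
    refine h2.congr' ?_
    filter_upwards [hev] with n ht
    have hn0 : (0 : ℝ) < n := by exact_mod_cast n.pos
    rw [ht]
    field_simp
  have hbounds : ∀ δ : ℝ, 0 < δ → ∀ᶠ n : ℕ+ in atTop,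
      (P n).real {ω | cover (R n) (U n) (scale μ (s - δ) n) ω = univ} -
        t n / (n / μ * δ) ^ 2 ≤ (P n).real {ω | contCover (R n) (U n) (N n) (t n) ω = univ} ∧
      (P n).real {ω | contCover (R n) (U n) (N n) (t n) ω = univ} ≤
        (P n).real {ω | cover (R n) (U n) (scale μ (s + δ) n) ω = univ} +
          t n / (n / μ * δ) ^ 2 := fun δ hδ => by
    filter_upwards [hev, eventually_log_add_pos (s - δ)] with n ht hs
    have hn0 : (0 : ℝ) < n := by exact_mod_cast n.pos
    refine (hN n).prob_contCovered_bounds (by positivity) ?_ fun j hj => ?_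
    · refine (Nat.floor_le (by positivity)).trans_eq ?_
      rw [ht]
      ring
    · refine Nat.le_floor (hj.trans_eq ?_)
      rw [ht]
      ring
  have hcont : Continuous fun u => Real.exp (-Real.exp (-u)) := by fun_prop
  refine tendsto_order.2 ⟨fun b hb => ?_, fun b hb => ?_⟩
  · have h1 : ∀ᶠ δ in 𝓝[>] (0 : ℝ), b < Real.exp (-Real.exp (-(s - δ))) := by
      have h2 : Tendsto (fun δ => Real.exp (-Real.exp (-(s - δ)))) (𝓝 0)
          (𝓝 (Real.exp (-Real.exp (-(s - 0))))) :=
        (hcont.comp (continuous_const.sub continuous_id)).tendsto 0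
      rw [sub_zero] at h2
      exact (h2.mono_left nhdsWithin_le_nhds).eventually_const_lt hb
    obtain ⟨δ, hδ, hδ0⟩ := (h1.and self_mem_nhdsWithin).exists
    have h3 := (hlim (s - δ)).sub (hvar δ)
    rw [sub_zero] at h3
    filter_upwards [h3.eventually_const_lt hδ, hbounds δ hδ0] with n h4 h5
    exact h4.trans_le h5.1
  · have h1 : ∀ᶠ δ in 𝓝[>] (0 : ℝ), Real.exp (-Real.exp (-(s + δ))) < b := by
      have h2 : Tendsto (fun δ => Real.exp (-Real.exp (-(s + δ)))) (𝓝 0)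
          (𝓝 (Real.exp (-Real.exp (-(s + 0))))) :=
        (hcont.comp (continuous_const.add continuous_id)).tendsto 0
      rw [add_zero] at h2
      exact (h2.mono_left nhdsWithin_le_nhds).eventually_lt_const hb
    obtain ⟨δ, hδ, hδ0⟩ := (h1.and self_mem_nhdsWithin).exists
    have h3 := (hlim (s + δ)).add (hvar δ)
    rw [add_zero] at h3
    filter_upwards [h3.eventually_lt_const hδ, hbounds δ hδ0] with n h4 h5
    exact h5.2.trans_lt h4

end Limit

end Covering

theorem theoremA
    (ρ : Measure ℕ) [IsProbabilityMeasure ρ] (hρ : ∀ᵐ r ∂ρ, 1 ≤ r)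
    (hmom : ∃ ε : ℝ, 0 < ε ∧ Integrable (fun r : ℕ => (r : ℝ) ^ (1 + ε)) ρ)
    (μ : ℝ) (hμ : μ = ∫ r : ℕ, (r : ℝ) ∂ρ)
    {Ω : ℕ+ → Type*} [∀ n, MeasurableSpace (Ω n)]
    (P : ∀ n, Measure (Ω n)) [∀ n, IsProbabilityMeasure (P n)]
    (R : ∀ n, ℕ → Ω n → ℕ) (U : ∀ n : ℕ+, ℕ → Ω n → ZMod n)
    (hRU : ∀ n, Covering.IsArcSequence (P n) ρ (R n) (U n)) :
    (∀ N : ∀ n, ℝ≥0 → Ω n → ℕ,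
      (∀ n, Covering.IsUnitPoissonProcess (P n) (N n)) →
      (∀ n, IndepFun (fun ω => ((fun k => R n k ω), (fun k => U n k ω)))
        (fun ω t => N n t ω) (P n)) →
      (∀ n, ∀ᵐ ω ∂P n, ∃ t, Covering.contCover (R n) (U n) (N n) t ω = Set.univ) ∧
      TendstoInDistribution
        (fun (n : ℕ+) ω =>
          μ / (n : ℝ) * (Covering.contCoverTime (R n) (U n) (N n) ω : ℝ) - Real.log n)
        atTop id P Covering.gumbel) ∧
    ((∀ n, ∀ᵐ ω ∂P n, ∃ k, Covering.cover (R n) (U n) k ω = Set.univ) ∧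
      TendstoInDistribution
        (fun (n : ℕ+) ω =>
          μ / (n : ℝ) * (Covering.discreteCoverTime (R n) (U n) ω : ℝ) - Real.log n)
        atTop id P Covering.gumbel) := by

  obtain ⟨ε, hε, hint⟩ := hmom
  refine ⟨fun N hN _ => ⟨fun n => (hRU n).ae_exists_contCovered hρ (hN n),
    Covering.tendstoInDistribution_gumbel (fun n => ?_)
      (Covering.tendsto_cdf_contCoverTime hρ hε hint hμ hRU hN)⟩,
    fun n => (hRU n).ae_exists_covered hρ,
    Covering.tendstoInDistribution_gumbel (fun n => ?_)
      (Covering.tendsto_cdf_discreteCoverTime hρ hε hint hμ hRU)⟩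
  · exact (((hRU n).aemeasurable_contCoverTime hρ (hN n)).coe_nnreal_real.const_mul _).sub_const _
  · exact ((Measurable.of_discrete.comp (hRU n).measurable_discreteCoverTime).aemeasurable.const_mul
      _).sub_const _
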